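/- Let $M$ be a smooth four-dimensional paracompact Hausdorff manifold; all fields are smooth. A (temporally oriented) classical spacetime is $(M,t_a,h^{ab},\nabla)$, where $t_a$ is a nowhere vanishing covector field (so that $t_at_b$ has signature $(1,0,0,0)$), $h^{ab}$ is a symmetric tensor field of signature $(0,1,1,1)$ with $h^{ab}t_b=0$, and $\nabla$ is a torsion-free derivative operator with $\nabla_a t_b=0$ and $\nabla_a h^{bc}=0$. A tangent vector $v^a$ is timelike if $t_at_bv^av^b>0$ and spacelike otherwise; a spacelike vector $v^a$ is a unit vector if $h^{ab}\sigma_a\sigma_b=1$ for some covector $\sigma_a$ with $h^{ab}\sigma_b=v^a$. The spacetime is spatially homogeneous and isotropic relative to a timelike vector field $\xi^a$ if for every $p\in M$ and any two unit spacelike vectors $\mu^a,\nu^a$ at $p$ there are an open set $O\ni p$ and a diffeomorphism $\varphi:O\to O$ that preserves $t_a$, $h^{ab}$, $\nabla$, $\xi^a$ and the point $p$, and maps $\mu^a$ to $\nu^a$. Let $T^{ab}$ be a tensor field (the mass-momentum tensor), and let $\rho=T^{ab}t_at_b$ be its mass density. An FLRW-like classical spacetime is $(M,t_a,h^{ab},\nabla,\xi^a,T^{ab})$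 where $(M,t_a,h^{ab},\nabla)$ is a classical spacetime that is spatially homogeneous and isotropic relative to the timelike vector field $\xi^a$, $T^{ab}=\rho\,\xi^a\xi^b+p\,h^{ab}$ for some scalar field $p$ (perfect fluid), and $R_{ab}=4\pi\rho\,t_at_b$ (geometrized Poisson equation), $R_{ab}$ being the Ricci tensor of $\nabla$. **Theorem.** Suppose that $(M,t_a,h^{ab},\nabla,\xi^a,T^{ab})$ is an FLRW-like classical spacetime satisfying the conservation condition $\nabla_aT^{ab}=0$ and the mass condition $\rho\ge 0$. Then either $\rho=0$ everywhere on $M$, or the spacetime is timelike geodesically incomplete: there is a maximal geodesic whose tangent vectors are all timelike and whose domain is not all of $\mathbb{R}$. -/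

import Mathlib

open scoped Manifold ContDiff

namespace Newtonian

noncomputable section

/-! ### Tensor fields and derivative operators on a four-dimensional manifold -/

/-- The model space `ℝ⁴`. -/
abbrev R4 : Type := EuclideanSpace ℝ (Fin 4)

/-- The tangent space at `x`. -/
abbrev Tan {M : Type*} [TopologicalSpace M] [ChartedSpace R4 M] (x : M) : Type :=
  TangentSpace (𝓡 4) x

/-- The cotangent space at `x`. -/
abbrev Cotan {M : Type*} [TopologicalSpace M] [ChartedSpace R4 M] (x : M) : Type :=
  Tan x →L[ℝ] ℝ

section Fields

variable (M : Type*) [TopologicalSpace M] [ChartedSpace R4 M]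

/-- Vector fields `X^a` (not necessarily smooth). -/
abbrev VField : Type _ := (x : M) → Tan x

/-- Covector fields `t_a` (not necessarily smooth). -/
abbrev CovField : Type _ := (x : M) → Cotan x

/-- Contravariant tensor fields `S^{ab}` of rank two (not necessarily smooth); `S x α β` is
`S^{ab} α_a β_b` at `x`. -/
abbrev BiField : Type _ := (x : M) → LinearMap.BilinForm ℝ (Cotan x)

/-- Covariant derivative operators `∇` on tangent vector fields; `D X x v` is `v^a ∇_a X^b` at
`x`. -/
abbrev Connection [IsManifold (𝓡 4) ∞ M] : Type _ :=
  CovariantDerivative (𝓡 4) R4 (fun x : M => TangentSpace (𝓡 4) x)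

end Fields

section Calculus

variable {M : Type*} [TopologicalSpace M] [ChartedSpace R4 M] [IsManifold (𝓡 4) ∞ M]

/-- The components of a tangent vector at `x` in the coordinates of the preferred chart at `x₀`
(meaningful when `x` is in the domain of that chart). -/
def coords (x₀ x : M) : Tan x →L[ℝ] R4 :=
  (trivializationAt R4 (TangentSpace (𝓡 4) : M → Type _) x₀).continuousLinearMapAt ℝ x

/-- The vector field, on the domain of the preferred chart at `x₀`, whose components in this chart
are the constants `e`. -/
def coordField (x₀ : M) (e : R4) : VField M := fun x =>
  (trivializationAt R4 (TangentSpace (𝓡 4) : M → Type _) x₀).symmL ℝ x e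

/-- The coordinate vector field `∂_i` of the preferred chart at `x₀`. -/
def partialField (x₀ : M) (i : Fin 4) : VField M := coordField x₀ (EuclideanSpace.single i 1)

/-- The coordinate covector field `dx^i` of the preferred chart at `x₀`. -/
def dxField (x₀ : M) (i : Fin 4) : CovField M := fun x =>
  (EuclideanSpace.proj i : R4 →L[ℝ] ℝ).comp (coords x₀ x)

/-- A vector field is smooth on `s`. -/
def SmoothVFieldOn (X : VField M) (s : Set M) : Prop :=
  ContMDiffOn (𝓡 4) (𝓡 4).tangent ∞ (fun x => (⟨x, X x⟩ : TangentBundle (𝓡 4) M)) s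

/-- A covector field is smooth: its components in the charts are. -/
def SmoothCov (t : CovField M) : Prop :=
  ∀ (x₀ : M) (i : Fin 4),
    ContMDiffOn (𝓡 4) 𝓘(ℝ, ℝ) ∞ (fun x => t x (partialField x₀ i x))
      (chartAt R4 x₀).source

/-- A contravariant rank two tensor field is smooth: its components in the charts are. -/
def SmoothBi (S : BiField M) : Prop :=
  ∀ (x₀ : M) (i j : Fin 4),
    ContMDiffOn (𝓡 4) 𝓘(ℝ, ℝ) ∞ (fun x => S x (dxField x₀ i x) (dxField x₀ j x))
      (chartAt R4 x₀).source

/-- The covariant derivative `v^a ∇_a α_b` at `x` of a covector field: its component along `∂_j` is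
`v(α(∂_j)) - α(∇_v ∂_j)`. -/
def nablaCov (D : Connection M) (α : CovField M) (x : M) (v : Tan x) : Cotan x :=
  ∑ j : Fin 4,
    (mvfderiv (𝓡 4) (fun y => α y (partialField x j y)) x v - α x (D (partialField x j) x v)) •
      dxField x j x

/-- The components `v^a ∇_a S^{ij}` at `x` of the covariant derivative of a contravariant rank two
tensor field, in the coordinates of the preferred chart at `x`:
`v(S(dx^i, dx^j)) - S(∇_v dx^i, dx^j) - S(dx^i, ∇_v dx^j)`. -/
def nablaBi (D : Connection M) (S : BiField M) (x : M) (v : Tan x) (i j : Fin 4) : ℝ :=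
  mvfderiv (𝓡 4) (fun y => S y (dxField x i y) (dxField x j y)) x v
    - S x (nablaCov D (dxField x i) x v) (dxField x j x)
    - S x (dxField x i x) (nablaCov D (dxField x j) x v)

/-- The components `∇_i S^{ij}` at `x` of the divergence of `S`, in the coordinates of the preferred
chart at `x`. -/
def divBi (D : Connection M) (S : BiField M) (x : M) (j : Fin 4) : ℝ :=
  ∑ i : Fin 4, nablaBi D S x (partialField x i x) i j

/-- The curvature `R(X, Y) Z = ∇_X ∇_Y Z - ∇_Y ∇_X Z - ∇_{[X, Y]} Z`. -/
def curvature (D : Connection M) (X Y Z : VField M) : VField M := fun x =>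
  D (fun y => D Z y (Y y)) x (X x) - D (fun y => D Z y (X y)) x (Y x)
    - D Z x (VectorField.mlieBracket (𝓡 4) X Y x)

/-- The components `R_{jk}` at `x` of the Ricci tensor in the coordinates of the preferred chart at
`x`: the trace of `v ↦ R(v, ∂_k) ∂_j`. -/
def ricci (D : Connection M) (x : M) (j k : Fin 4) : ℝ :=
  ∑ i : Fin 4,
    dxField x i x (curvature D (partialField x i) (partialField x k) (partialField x j) x)

/-! ### Classical spacetimes -/

/-- `(M, t_a, h^{ab}, ∇)` is a (temporally oriented) classical spacetime. -/
structure IsClassicalSpacetime (t : CovField M) (h : BiField M) (D : Connection M) : Prop where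
  smooth_t : SmoothCov t
  smooth_h : SmoothBi h
  smooth_D : CovariantDerivative.ContMDiffCovariantDerivative D ∞
  /-- `t_a t_b` has signature `(1, 0, 0, 0)`. -/
  t_ne_zero : ∀ x, t x ≠ 0
  /-- `h^{ab}` has signature `(0, 1, 1, 1)`. -/
  h_signature : ∀ x, ∃ b : Module.Basis (Fin 4) ℝ (Cotan x),
    ∀ i j, h x (b i) (b j) = if i = j ∧ i ≠ 0 then 1 else 0
  /-- `h^{ab} t_b = 0`. -/
  h_t : ∀ x α, h x α (t x) = 0
  torsion_free : D.torsion = 0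
  /-- `∇_a t_b = 0`. -/
  nabla_t : ∀ x v, nablaCov D t x v = 0
  /-- `∇_a h^{bc} = 0`. -/
  nabla_h : ∀ x v i j, nablaBi D h x v i j = 0

/-- A tangent vector is timelike: `t_a t_b v^a v^b > 0`. -/
def IsTimelike (t : CovField M) (x : M) (v : Tan x) : Prop := 0 < t x v * t x v

/-- A vector `v^a` at `x` is spacelike of spatial length `1`: it is not timelike and
`h^{ab} σ_a σ_b = 1` for a covector `σ_a` with `h^{ab} σ_b = v^a`. -/
def IsUnitSpacelike (t : CovField M) (h : BiField M) (x : M) (v : Tan x) : Prop :=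
  ¬ IsTimelike t x v ∧ ∃ σ : Cotan x, (∀ β : Cotan x, h x β σ = β v) ∧ h x σ σ = 1

/-- `φ` is a derivative operator preserving isometry from an open set onto an open set: a
diffeomorphism (from `φ.source` onto `φ.target`) that preserves `t_a`, `h^{ab}` and `∇`. -/
structure IsIsometryOn (t : CovField M) (h : BiField M) (D : Connection M)
    (φ : OpenPartialHomeomorph M M) : Prop where
  smooth : ContMDiffOn (𝓡 4) (𝓡 4) ∞ φ φ.source
  smooth_symm : ContMDiffOn (𝓡 4) (𝓡 4) ∞ φ.symm φ.target
  map_t : ∀ x ∈ φ.source, ∀ v : Tan x, t (φ x) (mfderiv (𝓡 4) (𝓡 4) φ x v) = t x v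
  map_h : ∀ x ∈ φ.source, ∀ α β : Cotan (φ x),
    h x (α.comp (mfderiv (𝓡 4) (𝓡 4) φ x)) (β.comp (mfderiv (𝓡 4) (𝓡 4) φ x)) = h (φ x) α β
  /-- If `Z` is the push-forward of `Y` under `φ`, then `∇_{φ_* v} Z` is the push-forward of
  `∇_v Y`. -/
  map_D : ∀ Y Z : VField M, SmoothVFieldOn Y φ.source → SmoothVFieldOn Z φ.target →
    (∀ x ∈ φ.source, mfderiv (𝓡 4) (𝓡 4) φ x (Y x) = Z (φ x)) →
    ∀ x ∈ φ.source, ∀ v : Tan x,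
      D Z (φ x) (mfderiv (𝓡 4) (𝓡 4) φ x v) = mfderiv (𝓡 4) (𝓡 4) φ x (D Y x v)

/-- Spatial homogeneity and isotropy relative to `ξ`: for all unit spacelike vectors `μ`, `ν` at any
point `p` there are an open set `O` containing `p` and an isometry `φ : O → O` that preserves `p`
and `ξ` and maps `μ` to `ν`. -/
def IsHomogeneousIsotropic (t : CovField M) (h : BiField M) (D : Connection M) (ξ : VField M) :
    Prop :=
  ∀ (p : M) (μ ν : Tan p), IsUnitSpacelike t h p μ → IsUnitSpacelike t h p ν →
    ∃ φ : OpenPartialHomeomorph M M, p ∈ φ.source ∧ φ.source = φ.target ∧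
      IsIsometryOn t h D φ ∧
      (∀ x ∈ φ.source, mfderiv (𝓡 4) (𝓡 4) φ x (ξ x) = ξ (φ x)) ∧
      tangentMap (𝓡 4) (𝓡 4) φ ⟨p, μ⟩ = ⟨p, ν⟩

/-- The mass density `ρ = T^{ab} t_a t_b`. -/
def massDensity (t : CovField M) (T : BiField M) (x : M) : ℝ := T x (t x) (t x)

/-- `(M, t_a, h^{ab}, ∇, ξ^a, T^{ab})` is an FLRW-like classical spacetime. -/
structure IsFLRWLike (t : CovField M) (h : BiField M) (D : Connection M) (ξ : VField M)
    (T : BiField M) : Prop where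
  spacetime : IsClassicalSpacetime t h D
  smooth_ξ : SmoothVFieldOn ξ Set.univ
  timelike_ξ : ∀ x, IsTimelike t x (ξ x)
  isotropic : IsHomogeneousIsotropic t h D ξ
  smooth_T : SmoothBi T
  /-- Perfect fluid: `T^{ab} = ρ ξ^a ξ^b + p h^{ab}`, where `ρ` is the mass density. -/
  perfect_fluid : ∃ p : M → ℝ, ContMDiff (𝓡 4) 𝓘(ℝ, ℝ) ∞ p ∧ ∀ (x : M) (α β : Cotan x),
    T x α β = massDensity t T x * (α (ξ x) * β (ξ x)) + p x * h x α β
  /-- Geometrized Poisson equation: `R_{ab} = 4 π ρ t_a t_b`. -/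
  poisson : ∀ (x : M) (j k : Fin 4), ricci D x j k =
    4 * Real.pi * massDensity t T x * (t x (partialField x j x) * t x (partialField x k x))

/-- The conservation condition `∇_a T^{ab} = 0`. -/
def ConservationCondition (D : Connection M) (T : BiField M) : Prop :=
  ∀ (x : M) (j : Fin 4), divBi D T x j = 0

/-- The mass condition `ρ ≥ 0`. -/
def MassCondition (t : CovField M) (T : BiField M) : Prop :=
  ∀ x, 0 ≤ massDensity t T x

/-! ### Geodesics -/

/-- The velocity of a curve. -/
def velocity (γ : ℝ → M) (s : ℝ) : Tan (γ s) := mfderiv 𝓘(ℝ, ℝ) (𝓡 4) γ s (1 : ℝ)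

/-- The covariant derivative at parameter `s` of a vector field `V` along a curve `γ`. With the
coordinate vector fields of the preferred chart at `γ s` and `V = V^i ∂_i`, it is
`(dV^i/ds) ∂_i + V^i ∇_{γ'} ∂_i`. -/
def nablaAlong (D : Connection M) (γ : ℝ → M) (V : (s : ℝ) → Tan (γ s)) (s : ℝ) : Tan (γ s) :=
  coordField (γ s) (deriv (fun r => coords (γ s) (γ r) (V r)) s) (γ s)
    + D (coordField (γ s) (coords (γ s) (γ s) (V s))) (γ s) (velocity γ s)

/-- `γ` restricted to `J` is a geodesic with `J` an open interval containing `0` (the values of `γ`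
outside `J` are irrelevant). -/
structure IsGeodesicOn (D : Connection M) (γ : ℝ → M) (J : Set ℝ) : Prop where
  isOpen : IsOpen J
  interval : J.OrdConnected
  zero_mem : (0 : ℝ) ∈ J
  smooth : ContMDiffOn 𝓘(ℝ, ℝ) (𝓡 4) ∞ γ J
  geodesic : ∀ s ∈ J, nablaAlong D γ (velocity γ) s = 0

/-- `γ : J → M` is a maximal geodesic: it extends every geodesic with the same initial point and the
same initial velocity. -/
def IsMaximalGeodesic (D : Connection M) (γ : ℝ → M) (J : Set ℝ) : Prop :=
  IsGeodesicOn D γ J ∧ ∀ (γ' : ℝ → M) (J' : Set ℝ), IsGeodesicOn D γ' J' →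
    (⟨γ' 0, velocity γ' 0⟩ : TangentBundle (𝓡 4) M) = ⟨γ 0, velocity γ 0⟩ →
    J' ⊆ J ∧ Set.EqOn γ' γ J'

/-- Timelike geodesic incompleteness: there is a maximal timelike geodesic whose domain is not all of
`ℝ`. -/
def IsTimelikeIncomplete (t : CovField M) (D : Connection M) : Prop :=
  ∃ (γ : ℝ → M) (J : Set ℝ), IsMaximalGeodesic D γ J ∧
    (∀ s ∈ J, IsTimelike t (γ s) (velocity γ s)) ∧ J ≠ Set.univ

end Calculus

end

end Newtonian

/-!
The proof is the Newtonian form of the singularity argument for Friedmann universes. It takes place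
where the mass density `ρ` does not vanish.

*Kinematics.* Contracting the perfect fluid form of `T^{ab}` with `t_b` gives
`T^{ab} t_b = ρ (t_c ξ^c) ξ^a`, hence `(t_a ξ^a)² = 1` where `ρ ≠ 0`. So `t_a ξ^a` is locally
constant there, and `∇_a t_b = 0` makes the image of `∇ξ` spacelike. The differentials at `p` of the
isometries fixing `p` and `ξ` commute with `∇ξ` and act transitively on unit spacelike vectors.
Therefore `ξ^a ∇_a ξ^b` vanishes (`nabla_self_eq_zero`: otherwise some such isometry would reverse
it). On the three-dimensional space of spacelike vectors `∇ξ` is a homothety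
(`exists_nabla_eq_smul`): it has a real eigenvector because the dimension is odd, and transitivity
carries that eigenvector to every line. With the expansion `θ = ∇_a ξ^a` this yields
`tr (∇ξ ∘ ∇ξ) = θ² / 3`.

*Dynamics.* Contracting `∇_a T^{ab} = 0` with `t_b` gives the continuity equation `ξ(ρ) = - θ ρ`
(`IsFLRWLike.mvfderiv_massDensity`). The trace of `v ↦ R(v, ξ) ξ` for a geodesic field and the
Poisson equation give the Raychaudhuri equation `ξ(θ) = - θ² / 3 - 4 π ρ`
(`IsFLRWLike.mvfderiv_expansion`).

*Geodesics.* A geodesic tangent to `ξ` at some parameter stays tangent to `ξ` nearby as long as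
`ρ ≠ 0`, since the components of the difference of the velocities solve a linear differential
equation (`IsGeodesicOn.eventually_velocity_eq`). Along it `ρ exp (∫ θ)` is constant, so `ρ` does
not reach zero and the tangency persists
(`IsFLRWLike.velocity_eq_and_massDensity_ne_zero`). Thus all
geodesics with initial velocity `ξ` at a point with mass are integral curves of `ξ`. They agree
on common parameters, and their union is the maximal geodesic
(`IsFLRWLike.exists_isMaximalGeodesic`). Were it defined on all of `ℝ`, then `θ` along it would be a
global solution of `θ' = - θ² / 3 - k` with `k = 4 π ρ > 0`, and there is none (`not_riccati`).
-/

namespace Newtonian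

open Bundle Set Filter Topology

noncomputable section

variable {M : Type*} [TopologicalSpace M] [ChartedSpace R4 M] [IsManifold (𝓡 4) ∞ M]

/-! ### Coordinate fields -/

theorem coords_coordField {x₀ x : M} (hx : x ∈ (chartAt R4 x₀).source) (e : R4) :
    coords x₀ x (coordField x₀ e x) = e :=
  (trivializationAt R4 (TangentSpace (𝓡 4) : M → Type _) x₀).continuousLinearMapAt_symmL (R := ℝ)
    hx e

theorem coordField_coords {x₀ x : M} (hx : x ∈ (chartAt R4 x₀).source) (v : Tan x) :
    coordField x₀ (coords x₀ x v) x = v :=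
  (trivializationAt R4 (TangentSpace (𝓡 4) : M → Type _) x₀).symmL_continuousLinearMapAt (R := ℝ)
    hx v

theorem coordField_eq_sum (x₀ : M) (e : R4) (x : M) :
    coordField x₀ e x = ∑ i, e i • partialField x₀ i x := by
  have h : e = ∑ i, e i • EuclideanSpace.single i (1 : ℝ) := by
    ext j
    simp [Pi.single_apply]
  conv_lhs => rw [h]
  simp only [coordField, partialField, map_sum, map_smul]

theorem dxField_apply (x₀ : M) (i : Fin 4) (x : M) (v : Tan x) :
    dxField x₀ i x v = coords x₀ x v i := rfl

theorem dxField_partialField {x₀ x : M} (hx : x ∈ (chartAt R4 x₀).source) (i j : Fin 4) :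
    dxField x₀ i x (partialField x₀ j x) = if i = j then 1 else 0 := by
  rw [dxField_apply, partialField, coords_coordField hx]
  simp [PiLp.single_apply]

theorem sum_dxField_smul_partialField {x₀ x : M} (hx : x ∈ (chartAt R4 x₀).source) (v : Tan x) :
    ∑ i, dxField x₀ i x v • partialField x₀ i x = v := by
  conv_rhs => rw [← coordField_coords hx v, coordField_eq_sum]
  rfl

theorem smoothVFieldOn_coordField (x₀ : M) (e : R4) :
    SmoothVFieldOn (coordField x₀ e) (chartAt R4 x₀).source := by
  refine ((trivializationAt R4 (TangentSpace (𝓡 4) : M → Type _)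
    x₀).contMDiffOn_section_baseSet_iff (IB := 𝓡 4) (n := ∞)).2 ?_
  refine (contMDiffOn_const (c := e)).congr fun y hy => ?_
  have := coords_coordField (x₀ := x₀) (x := y) hy e
  rw [coords, Trivialization.continuousLinearMapAt_apply, Trivialization.linearMapAt_apply,
    if_pos hy] at this
  exact this

theorem smoothVFieldOn_partialField (x₀ : M) (i : Fin 4) :
    SmoothVFieldOn (partialField x₀ i) (chartAt R4 x₀).source :=
  smoothVFieldOn_coordField x₀ _

theorem SmoothVFieldOn.coords {X : VField M} {x₀ : M} {U : Set M} (hX : SmoothVFieldOn X U)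
    (hUo : IsOpen U) (hU : U ⊆ (chartAt R4 x₀).source) :
    ContMDiffOn (𝓡 4) 𝓘(ℝ, R4) ∞ (fun x => coords x₀ x (X x)) U := by
  have h := ((trivializationAt R4 (TangentSpace (𝓡 4) : M → Type _)
    x₀).contMDiffOn_section_iff (IB := 𝓡 4) (n := ∞) (s := X) hUo hU).1 hX
  refine h.congr fun y hy => ?_
  rw [Newtonian.coords, Trivialization.continuousLinearMapAt_apply,
    Trivialization.linearMapAt_apply]
  exact if_pos (hU hy)

theorem SmoothVFieldOn.dxField {X : VField M} {x₀ : M} {U : Set M} (hX : SmoothVFieldOn X U)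
    (hUo : IsOpen U) (hU : U ⊆ (chartAt R4 x₀).source) (i : Fin 4) :
    ContMDiffOn (𝓡 4) 𝓘(ℝ, ℝ) ∞ (fun x => dxField x₀ i x (X x)) U :=
  (EuclideanSpace.proj i : R4 →L[ℝ] ℝ).contDiff.contMDiff.comp_contMDiffOn (hX.coords hUo hU)

/-! ### Covariant derivatives of vector fields -/

/-- A vector field is smooth at `x`. -/
abbrev SmoothVFieldAt (X : VField M) (x : M) : Prop :=
  ContMDiffAt (𝓡 4) (𝓡 4).tangent ∞ (fun x => (⟨x, X x⟩ : TangentBundle (𝓡 4) M)) x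

/-- A vector field is differentiable at `x`. -/
abbrev DiffVFieldAt (X : VField M) (x : M) : Prop :=
  MDifferentiableAt (𝓡 4) (𝓡 4).tangent (fun x => (⟨x, X x⟩ : TangentBundle (𝓡 4) M)) x

/-- A scalar field is differentiable at `x`. -/
abbrev DiffFunAt (f : M → ℝ) (x : M) : Prop := MDifferentiableAt (𝓡 4) 𝓘(ℝ, ℝ) f x

theorem SmoothVFieldOn.mono {X : VField M} {U V : Set M} (hX : SmoothVFieldOn X U) (h : V ⊆ U) :
    SmoothVFieldOn X V :=
  ContMDiffOn.mono hX h

theorem SmoothVFieldOn.contMDiffAt {X : VField M} {U : Set M} (hX : SmoothVFieldOn X U)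
    (hU : IsOpen U) {x : M} (hx : x ∈ U) : SmoothVFieldAt X x :=
  ContMDiffOn.contMDiffAt hX (hU.mem_nhds hx)

theorem SmoothVFieldOn.mdiffAt {X : VField M} {U : Set M} (hX : SmoothVFieldOn X U)
    (hU : IsOpen U) {x : M} (hx : x ∈ U) : DiffVFieldAt X x :=
  (hX.contMDiffAt hU hx).mdifferentiableAt (by simp)

theorem SmoothVFieldOn.smul {X : VField M} {U : Set M} (hX : SmoothVFieldOn X U) {f : M → ℝ}
    (hf : ContMDiffOn (𝓡 4) 𝓘(ℝ, ℝ) ∞ f U) : SmoothVFieldOn (fun y => f y • X y) U :=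
  ContMDiffOn.smul_section hf hX

theorem SmoothVFieldOn.sum {ι : Type*} {s : Finset ι} {X : ι → VField M} {U : Set M}
    (hX : ∀ i ∈ s, SmoothVFieldOn (X i) U) : SmoothVFieldOn (fun y => ∑ i ∈ s, X i y) U :=
  ContMDiffOn.sum_section hX

omit [IsManifold (𝓡 4) ∞ M] in
theorem _root_.ContMDiffOn.mdiffAt {f : M → ℝ} {U : Set M}
    (hf : ContMDiffOn (𝓡 4) 𝓘(ℝ, ℝ) ∞ f U) (hU : IsOpen U) {x : M} (hx : x ∈ U) :
    DiffFunAt f x :=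
  (hf.contMDiffAt (hU.mem_nhds hx)).mdifferentiableAt (by simp)

/-- A vector field which is smooth near `x` agrees near `x` with a globally smooth one. -/
theorem SmoothVFieldOn.exists_global [T2Space M] {X : VField M} {U : Set M}
    (hX : SmoothVFieldOn X U) (hU : IsOpen U) {x : M} (hx : x ∈ U) :
    ∃ Y : VField M, SmoothVFieldOn Y univ ∧ ∀ᶠ y in 𝓝 x, Y y = X y := by
  obtain ⟨f, -, hf⟩ := (SmoothBumpFunction.nhds_basis_tsupport (I := 𝓡 4) x).mem_iff.1
    (hU.mem_nhds hx)
  refine ⟨fun y => f y • X y, ?_, ?_⟩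
  · exact contMDiffOn_univ.2 (ContMDiffOn.smul_section_of_tsupport
      (f.contMDiff.contMDiffOn (s := U)) hU hf hX)
  · filter_upwards [f.eventuallyEq_one] with y hy
    simp [hy]

/-- Covariant derivatives are local. Differentiability is needed on both sides because the value of
a derivative operator on other fields is arbitrary. -/
theorem nabla_congr (D : Connection M) {X Y : VField M} {x : M} (hX : DiffVFieldAt X x)
    (hY : DiffVFieldAt Y x) (h : ∀ᶠ y in 𝓝 x, X y = Y y) : D X x = D Y x :=
  D.isCovariantDerivativeOnUniv.congr_of_eventuallyEq hX hY univ_mem h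

theorem mdiffAt_congr {X Y : VField M} {x : M} (hX : DiffVFieldAt X x)
    (h : ∀ᶠ y in 𝓝 x, Y y = X y) : DiffVFieldAt Y x := by
  refine hX.congr_of_eventuallyEq ?_
  filter_upwards [h] with y hy
  rw [hy]

theorem nabla_smul (D : Connection M) {f : M → ℝ} {X : VField M} {x : M} (hf : DiffFunAt f x)
    (hX : DiffVFieldAt X x) (v : Tan x) :
    D (fun y => f y • X y) x v = f x • D X x v + mvfderiv (𝓡 4) f x v • X x := by
  have h := D.isCovariantDerivativeOnUniv.leibniz hX hf
  exact congrArg (fun L : Tan x →L[ℝ] Tan x => L v) h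

theorem nabla_add (D : Connection M) {X Y : VField M} {x : M} (hX : DiffVFieldAt X x)
    (hY : DiffVFieldAt Y x) (v : Tan x) :
    D (fun y => X y + Y y) x v = D X x v + D Y x v := by
  have h := D.isCovariantDerivativeOnUniv.add hX hY
  exact congrArg (fun L : Tan x →L[ℝ] Tan x => L v) h

theorem nabla_sum (D : Connection M) {ι : Type*} (s : Finset ι) {X : ι → VField M} {x : M}
    (hX : ∀ i ∈ s, DiffVFieldAt (X i) x) (v : Tan x) :
    D (fun y => ∑ i ∈ s, X i y) x v = ∑ i ∈ s, D (X i) x v := by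
  classical
  induction s using Finset.induction_on with
  | empty =>
    have h := D.isCovariantDerivativeOnUniv.zero (x := x)
    simp only [Finset.sum_empty]
    exact congrArg (fun L : Tan x →L[ℝ] Tan x => L v) h
  | insert i s hi ih =>
    simp only [Finset.sum_insert hi]
    rw [nabla_add D (hX i (by simp))
      (MDifferentiableAt.sum_section fun j hj => hX j (Finset.mem_insert_of_mem hj)),
      ih fun j hj => hX j (Finset.mem_insert_of_mem hj)]

theorem nabla_sum_smul (D : Connection M) {ι : Type*} (s : Finset ι) {f : ι → M → ℝ}
    {X : ι → VField M} {x : M} (hf : ∀ i ∈ s, DiffFunAt (f i) x)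
    (hX : ∀ i ∈ s, DiffVFieldAt (X i) x) (v : Tan x) :
    D (fun y => ∑ i ∈ s, f i y • X i y) x v =
      ∑ i ∈ s, (f i x • D (X i) x v + mvfderiv (𝓡 4) (f i) x v • X i x) := by
  rw [nabla_sum D s (X := fun i y => f i y • X i y) fun i hi =>
    MDifferentiableAt.smul_section (hf i hi) (hX i hi)]
  exact Finset.sum_congr rfl fun i hi => nabla_smul D (hf i hi) (hX i hi) v

/-- Smoothness of a derivative operator speaks of globally smooth fields; by locality and bump
functions it extends to fields which are smooth on an open set only. -/
theorem SmoothVFieldOn.nabla [T2Space M] {D : Connection M}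
    (hD : CovariantDerivative.ContMDiffCovariantDerivative D ∞) {X Y : VField M} {U : Set M}
    (hX : SmoothVFieldOn X U) (hY : SmoothVFieldOn Y U) (hU : IsOpen U) :
    SmoothVFieldOn (fun y => D X y (Y y)) U := by
  intro x hx
  obtain ⟨X', hX', hXX'⟩ := hX.exists_global hU hx
  have h1 := hD.contMDiff.contMDiff (σ := X') hX'
  have h2 : SmoothVFieldAt (fun y => D X' y (Y y)) x :=
    (h1.contMDiffAt univ_mem).clm_bundle_apply (hY.contMDiffAt hU hx)
  refine ContMDiffAt.contMDiffWithinAt (h2.congr_of_eventuallyEq ?_)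
  filter_upwards [hXX'.eventually_nhds, hU.mem_nhds hx] with y hy hyU
  have : D X y = D X' y := nabla_congr D (hX.mdiffAt hU hyU) (hX'.mdiffAt isOpen_univ trivial)
    (hy.mono fun _ h => h.symm)
  rw [this]

/-! ### Lie brackets and directional derivatives -/

theorem SmoothVFieldOn.mlieBracket {X Y : VField M} {U : Set M} (hX : SmoothVFieldOn X U)
    (hY : SmoothVFieldOn Y U) (hU : IsOpen U) :
    SmoothVFieldOn (VectorField.mlieBracket (𝓡 4) X Y) U := by
  intro x hx
  have : IsManifold (𝓡 4) (((⊤ : ℕ∞) : WithTop ℕ∞) + 1) M := inferInstanceAs (IsManifold (𝓡 4) ∞ M)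
  have : IsManifold (𝓡 4) (minSmoothness ℝ 2) M :=
    IsManifold.of_le (n := ∞) (by simpa using ENat.LEInfty.out)
  exact ((hX.contMDiffAt hU hx).mlieBracket_vectorField (m := ⊤) (n := ⊤)
    (hY.contMDiffAt hU hx) (by simp)).contMDiffWithinAt

theorem mlieBracket_smul {f : M → ℝ} {X Y : VField M} {x : M} (hf : DiffFunAt f x)
    (hY : DiffVFieldAt Y x) :
    VectorField.mlieBracket (𝓡 4) X (fun y => f y • Y y) x =
      mvfderiv (𝓡 4) f x (X x) • Y x + f x • VectorField.mlieBracket (𝓡 4) X Y x :=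
  VectorField.mlieBracket_smul_right hf hY

/-- The directional derivative `X f` is smooth: it can be read off from the smooth fields
`[X, f ∂_0]` and `f [X, ∂_0]`. -/
theorem contMDiffOn_mvfderiv {f : M → ℝ} {X : VField M} {U : Set M} (hU : IsOpen U)
    (hf : ContMDiffOn (𝓡 4) 𝓘(ℝ, ℝ) ∞ f U) (hX : SmoothVFieldOn X U) :
    ContMDiffOn (𝓡 4) 𝓘(ℝ, ℝ) ∞ (fun y => mvfderiv (𝓡 4) f y (X y)) U := by
  intro x hx
  set V := U ∩ (chartAt R4 x).source
  have hV : IsOpen V := hU.inter (chartAt R4 x).open_source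
  have hxV : x ∈ V := ⟨hx, mem_chart_source R4 x⟩
  have hZ : SmoothVFieldOn (partialField x 0) V :=
    (smoothVFieldOn_partialField x 0).mono inter_subset_right
  have hfV := hf.mono (inter_subset_left (s := U) (t := (chartAt R4 x).source))
  have hXV := hX.mono (inter_subset_left (s := U) (t := (chartAt R4 x).source))
  have h1 := (hXV.mlieBracket (hZ.smul hfV) hV).dxField hV inter_subset_right 0
  have h2 := (hXV.mlieBracket hZ hV).dxField hV inter_subset_right 0
  have h3 := h1.sub (hfV.mul h2)
  have h4 : ContMDiffOn (𝓡 4) 𝓘(ℝ, ℝ) ∞ (fun y => mvfderiv (𝓡 4) f y (X y)) V := by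
    refine h3.congr fun y hy => ?_
    rw [mlieBracket_smul (hfV.mdiffAt hV hy) (hZ.mdiffAt hV hy), map_add, map_smul, map_smul,
      dxField_partialField hy.2]
    simp
  exact (h4.contMDiffAt (hV.mem_nhds hxV)).contMDiffWithinAt

/-- The commutator formula `[X, Y] f = X (Y f) - Y (X f)`, which is the Jacobi identity for
`X`, `Y` and `f Z`. -/
theorem mvfderiv_mlieBracket {f : M → ℝ} {X Y : VField M} {U : Set M} (hU : IsOpen U)
    (hf : ContMDiffOn (𝓡 4) 𝓘(ℝ, ℝ) ∞ f U) (hX : SmoothVFieldOn X U) (hY : SmoothVFieldOn Y U)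
    {x : M} (hx : x ∈ U) :
    mvfderiv (𝓡 4) f x (VectorField.mlieBracket (𝓡 4) X Y x) =
      mvfderiv (𝓡 4) (fun y => mvfderiv (𝓡 4) f y (Y y)) x (X x) -
      mvfderiv (𝓡 4) (fun y => mvfderiv (𝓡 4) f y (X y)) x (Y x) := by
  have : IsManifold (𝓡 4) (minSmoothness ℝ 3) M :=
    IsManifold.of_le (n := ∞) (by simpa using ENat.LEInfty.out)
  set V := U ∩ (chartAt R4 x).source
  have hV : IsOpen V := hU.inter (chartAt R4 x).open_source
  have hxV : x ∈ V := ⟨hx, mem_chart_source R4 x⟩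
  set Z := partialField x 0
  have hZ : SmoothVFieldOn Z V :=
    (smoothVFieldOn_partialField x 0).mono inter_subset_right
  have hfV := hf.mono (inter_subset_left (s := U) (t := (chartAt R4 x).source))
  have hXV := hX.mono (inter_subset_left (s := U) (t := (chartAt R4 x).source))
  have hYV := hY.mono (inter_subset_left (s := U) (t := (chartAt R4 x).source))
  have hC2 {W : VField M} (hW : SmoothVFieldOn W V) :
      ContMDiffAt (𝓡 4) (𝓡 4).tangent (minSmoothness ℝ 2)
        (fun x => (⟨x, W x⟩ : TangentBundle (𝓡 4) M)) x :=
    (hW.contMDiffAt hV hxV).of_le (by simpa using ENat.LEInfty.out)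
  have hJ (W : VField M) (hW : SmoothVFieldOn W V) :=
    VectorField.leibniz_identity_mlieBracket_apply (hC2 hXV) (hC2 hYV) (hC2 hW)
  -- the expansion of a double bracket `[X, [Y, f Z]]`
  have hexp {X Y : VField M} (hX : SmoothVFieldOn X V) (hY : SmoothVFieldOn Y V) :
      VectorField.mlieBracket (𝓡 4) X
        (VectorField.mlieBracket (𝓡 4) Y fun y => f y • Z y) x =
      mvfderiv (𝓡 4) (fun y => mvfderiv (𝓡 4) f y (Y y)) x (X x) • Z x +
        mvfderiv (𝓡 4) f x (Y x) • VectorField.mlieBracket (𝓡 4) X Z x +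
        (mvfderiv (𝓡 4) f x (X x) • VectorField.mlieBracket (𝓡 4) Y Z x +
        f x • VectorField.mlieBracket (𝓡 4) X (VectorField.mlieBracket (𝓡 4) Y Z) x) := by
    have h1 : VectorField.mlieBracket (𝓡 4) X
        (VectorField.mlieBracket (𝓡 4) Y fun y => f y • Z y) x =
        VectorField.mlieBracket (𝓡 4) X (fun y => mvfderiv (𝓡 4) f y (Y y) • Z y +
          f y • VectorField.mlieBracket (𝓡 4) Y Z y) x := by
      refine Filter.EventuallyEq.mlieBracket_vectorField_eq (EventuallyEq.refl _ _) ?_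
      filter_upwards [hV.mem_nhds hxV] with y hy
      exact mlieBracket_smul (hfV.mdiffAt hV hy) (hZ.mdiffAt hV hy)
    have hYf := contMDiffOn_mvfderiv hV hfV hY
    have hYZ := hY.mlieBracket hZ hV
    have h2 := VectorField.mlieBracket_add_right (V := X) ((hZ.smul hYf).mdiffAt hV hxV)
      ((hYZ.smul hfV).mdiffAt hV hxV)
    rw [h1]
    refine h2.trans ?_
    rw [mlieBracket_smul (hYf.mdiffAt hV hxV) (hZ.mdiffAt hV hxV),
      mlieBracket_smul (hfV.mdiffAt hV hxV) (hYZ.mdiffAt hV hxV)]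
  have h1 := hJ _ (hZ.smul hfV)
  have h2 := hJ _ hZ
  rw [hexp hXV hYV, hexp hYV hXV, mlieBracket_smul (hfV.mdiffAt hV hxV) (hZ.mdiffAt hV hxV), h2]
    at h1
  have h3 := congrArg (dxField x 0 x) h1
  simp only [map_add, map_smul, smul_eq_mul] at h3
  rw [show dxField x 0 x (Z x) = 1 by rw [dxField_partialField hxV.2]; simp] at h3
  linear_combination -h3

/-! ### Traces and the expansion -/

/-- The coordinate basis of the tangent space at a point of the domain of the chart at `x₀`. -/
def coordBasis {x₀ x : M} (hx : x ∈ (chartAt R4 x₀).source) : Module.Basis (Fin 4) ℝ (Tan x) :=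
  Module.Basis.ofEquivFun
    { toFun := fun v i => dxField x₀ i x v
      map_add' := fun v w => by ext i; simp
      map_smul' := fun c v => by ext i; simp
      invFun := fun c => ∑ i, c i • partialField x₀ i x
      left_inv := fun v => sum_dxField_smul_partialField hx v
      right_inv := fun c => by
        ext i
        simp [map_sum, dxField_partialField hx] }

theorem coordBasis_repr {x₀ x : M} (hx : x ∈ (chartAt R4 x₀).source) (v : Tan x) (i : Fin 4) :
    (coordBasis hx).repr v i = dxField x₀ i x v := by
  rw [← Module.Basis.equivFun_apply, coordBasis, Module.Basis.equivFun_ofEquivFun]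
  rfl

theorem coordBasis_apply {x₀ x : M} (hx : x ∈ (chartAt R4 x₀).source) (i : Fin 4) :
    coordBasis hx i = partialField x₀ i x := by
  rw [coordBasis, Module.Basis.coe_ofEquivFun]
  change ∑ j, (Pi.single i (1 : ℝ) : Fin 4 → ℝ) j • partialField x₀ j x = _
  simp [Pi.single_apply]

theorem trace_eq_sum {x₀ x : M} (hx : x ∈ (chartAt R4 x₀).source) (L : Tan x →ₗ[ℝ] Tan x) :
    LinearMap.trace ℝ (Tan x) L = ∑ i, dxField x₀ i x (L (partialField x₀ i x)) := by
  rw [LinearMap.trace_eq_matrix_trace ℝ (coordBasis hx), Matrix.trace]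
  refine Finset.sum_congr rfl fun i _ => ?_
  rw [Matrix.diag_apply, LinearMap.toMatrix_apply, coordBasis_repr, coordBasis_apply]

/-- The expansion `θ = ∇_a X^a` of a vector field. -/
def expansion (D : Connection M) (X : VField M) (x : M) : ℝ :=
  LinearMap.trace ℝ (Tan x) (D X x).toLinearMap

theorem expansion_eq_sum (D : Connection M) (X : VField M) {x₀ x : M}
    (hx : x ∈ (chartAt R4 x₀).source) :
    expansion D X x = ∑ i, dxField x₀ i x (D X x (partialField x₀ i x)) :=
  trace_eq_sum hx _

theorem contMDiff_expansion [T2Space M] {D : Connection M}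
    (hD : CovariantDerivative.ContMDiffCovariantDerivative D ∞) {X : VField M}
    (hX : SmoothVFieldOn X univ) : ContMDiff (𝓡 4) 𝓘(ℝ, ℝ) ∞ (expansion D X) := by
  intro x
  have hO := (chartAt R4 x).open_source
  have h : ContMDiffOn (𝓡 4) 𝓘(ℝ, ℝ) ∞
      (fun y => ∑ i, dxField x i y (D X y (partialField x i y))) (chartAt R4 x).source :=
    contMDiffOn_finsetSum fun i _ => ((hX.mono (subset_univ _)).nabla hD
      (smoothVFieldOn_partialField x i) hO).dxField hO subset_rfl i
  have h' := h.congr fun y hy => expansion_eq_sum D X hy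
  exact h'.contMDiffAt (hO.mem_nhds (mem_chart_source R4 x))

omit [IsManifold (𝓡 4) ∞ M] in
theorem mvfderiv_congr {f g : M → ℝ} {x : M} (h : f =ᶠ[𝓝 x] g) :
    mvfderiv (𝓡 4) f x = mvfderiv (𝓡 4) g x := by
  ext v
  have h1 := h.mfderiv_eq (I := 𝓡 4) (I' := 𝓘(ℝ, ℝ))
  exact congrArg (fun L : Tan x →L[ℝ] ℝ => L v) h1

omit [IsManifold (𝓡 4) ∞ M] in
theorem mvfderiv_sum {ι : Type} (s : Finset ι) {f : ι → M → ℝ} {x : M}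
    (hf : ∀ i ∈ s, DiffFunAt (f i) x) (v : Tan x) :
    mvfderiv (𝓡 4) (fun y => ∑ i ∈ s, f i y) x v = ∑ i ∈ s, mvfderiv (𝓡 4) (f i) x v := by
  classical
  induction s using Finset.induction_on with
  | empty => simp [mvfderiv_const]
  | insert i s hi ih =>
    have hs : DiffFunAt (fun y => ∑ i ∈ s, f i y) x := by
      have : DiffFunAt (∑ i ∈ s, f i) x :=
        MDifferentiableAt.sum fun j hj => hf j (Finset.mem_insert_of_mem hj)
      rwa [Finset.sum_fn] at this
    simp only [Finset.sum_insert hi]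
    rw [mvfderiv_fun_add (hf i (Finset.mem_insert_self i s)) hs, add_apply,
      ih fun j hj => hf j (Finset.mem_insert_of_mem hj)]

/-! ### Curvature and the Raychaudhuri equation -/

section TorsionFree

variable {D : Connection M}

theorem mlieBracket_eq_nabla_sub (hT : D.torsion = 0) {X Y : VField M} {x : M}
    (hX : DiffVFieldAt X x) (hY : DiffVFieldAt Y x) :
    VectorField.mlieBracket (𝓡 4) X Y x = D Y x (X x) - D X x (Y x) :=
  (D.torsion_eq_zero_iff.1 hT hX hY).symm

variable [T2Space M] (hD : CovariantDerivative.ContMDiffCovariantDerivative D ∞)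

include hD

/-- The curvature is local in its last two arguments. -/
theorem curvature_congr {X Y Y' Z Z' : VField M} {U : Set M}
    (hU : IsOpen U) (hX : SmoothVFieldOn X U) (hY : SmoothVFieldOn Y U) (hZ : SmoothVFieldOn Z U)
    (hYY' : ∀ y ∈ U, Y' y = Y y) (hZZ' : ∀ y ∈ U, Z' y = Z y) {x : M} (hx : x ∈ U) :
    curvature D X Y Z x = curvature D X Y' Z' x := by
  have hZ' : SmoothVFieldOn Z' U := ContMDiffOn.congr hZ fun y hy => by rw [hZZ' y hy]
  have hY' : SmoothVFieldOn Y' U := ContMDiffOn.congr hY fun y hy => by rw [hYY' y hy]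
  have hDZ : ∀ y ∈ U, D Z y = D Z' y := fun y hy =>
    nabla_congr D (hZ.mdiffAt hU hy) (hZ'.mdiffAt hU hy)
      (eventually_of_mem (hU.mem_nhds hy) fun z hz => (hZZ' z hz).symm)
  have h1 : D (fun y => D Z y (Y y)) x = D (fun y => D Z' y (Y' y)) x :=
    nabla_congr D ((hZ.nabla hD hY hU).mdiffAt hU hx) ((hZ'.nabla hD hY' hU).mdiffAt hU hx)
      (eventually_of_mem (hU.mem_nhds hx) fun z hz => by rw [hDZ z hz, hYY' z hz])
  have h2 : D (fun y => D Z y (X y)) x = D (fun y => D Z' y (X y)) x :=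
    nabla_congr D ((hZ.nabla hD hX hU).mdiffAt hU hx) ((hZ'.nabla hD hX hU).mdiffAt hU hx)
      (eventually_of_mem (hU.mem_nhds hx) fun z hz => by rw [hDZ z hz])
  have h3 : VectorField.mlieBracket (𝓡 4) X Y x = VectorField.mlieBracket (𝓡 4) X Y' x :=
    Filter.EventuallyEq.mlieBracket_vectorField_eq (EventuallyEq.refl _ _)
      (eventually_of_mem (hU.mem_nhds hx) fun z hz => (hYY' z hz).symm)
  rw [curvature, curvature, h1, h2, h3, hYY' x hx, hDZ x hx]

/-- The curvature is linear over the scalar fields in its last argument. -/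
theorem curvature_sum_smul_third {ι : Type*} (s : Finset ι) {X Y : VField M} {U : Set M}
    (hU : IsOpen U) (hX : SmoothVFieldOn X U) (hY : SmoothVFieldOn Y U) {f : ι → M → ℝ}
    {Z : ι → VField M} (hf : ∀ i ∈ s, ContMDiffOn (𝓡 4) 𝓘(ℝ, ℝ) ∞ (f i) U)
    (hZ : ∀ i ∈ s, SmoothVFieldOn (Z i) U) {x : M} (hx : x ∈ U) :
    curvature D X Y (fun y => ∑ i ∈ s, f i y • Z i y) x =
      ∑ i ∈ s, f i x • curvature D X Y (Z i) x := by
  -- the second derivatives of the coefficients cancel against `[X, Y]` by the commutator formula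
  have key {X Y : VField M} (hX : SmoothVFieldOn X U) (hY : SmoothVFieldOn Y U) :
      D (fun y => D (fun y => ∑ i ∈ s, f i y • Z i y) y (Y y)) x (X x) =
      ∑ i ∈ s, (f i x • D (fun y => D (Z i) y (Y y)) x (X x) +
        mvfderiv (𝓡 4) (f i) x (X x) • D (Z i) x (Y x) +
        (mvfderiv (𝓡 4) (f i) x (Y x) • D (Z i) x (X x) +
        mvfderiv (𝓡 4) (fun y => mvfderiv (𝓡 4) (f i) y (Y y)) x (X x) • Z i x)) := by
    have h1 : D (fun y => D (fun y => ∑ i ∈ s, f i y • Z i y) y (Y y)) x =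
        D (fun y => ∑ i ∈ s, (f i y • D (Z i) y (Y y) +
          mvfderiv (𝓡 4) (f i) y (Y y) • Z i y)) x := by
      have hs : SmoothVFieldOn (fun y => D (fun y => ∑ i ∈ s, f i y • Z i y) y (Y y)) U :=
        SmoothVFieldOn.nabla hD
          (SmoothVFieldOn.sum (X := fun i y => f i y • Z i y) fun i hi => (hZ i hi).smul (hf i hi))
          hY hU
      have he : ∀ᶠ y in 𝓝 x, D (fun y => ∑ i ∈ s, f i y • Z i y) y (Y y) =
          ∑ i ∈ s, (f i y • D (Z i) y (Y y) + mvfderiv (𝓡 4) (f i) y (Y y) • Z i y) := by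
        filter_upwards [hU.mem_nhds hx] with y hy
        exact nabla_sum_smul D s (fun i hi => (hf i hi).mdiffAt hU hy)
          (fun i hi => (hZ i hi).mdiffAt hU hy) (Y y)
      exact nabla_congr D (hs.mdiffAt hU hx)
        (mdiffAt_congr (hs.mdiffAt hU hx) (he.mono fun _ h => h.symm)) he
    have h2 (i : ι) (hi : i ∈ s) := (((hZ i hi).nabla hD hY hU).smul (hf i hi)).mdiffAt hU hx
    have h3 (i : ι) (hi : i ∈ s) :=
      ((hZ i hi).smul (contMDiffOn_mvfderiv hU (hf i hi) hY)).mdiffAt hU hx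
    rw [h1, nabla_sum D s (X := fun i y => f i y • D (Z i) y (Y y) +
          mvfderiv (𝓡 4) (f i) y (Y y) • Z i y)
      fun i hi => mdifferentiableAt_add_section (h2 i hi) (h3 i hi)]
    refine Finset.sum_congr rfl fun i hi => ?_
    rw [nabla_add D (h2 i hi) (h3 i hi),
      nabla_smul D ((hf i hi).mdiffAt hU hx) (((hZ i hi).nabla hD hY hU).mdiffAt hU hx),
      nabla_smul D ((contMDiffOn_mvfderiv hU (hf i hi) hY).mdiffAt hU hx)
        ((hZ i hi).mdiffAt hU hx)]
  rw [curvature, key hX hY, key hY hX, nabla_sum_smul D s (fun i hi => (hf i hi).mdiffAt hU hx)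
    (fun i hi => (hZ i hi).mdiffAt hU hx), ← Finset.sum_sub_distrib, ← Finset.sum_sub_distrib]
  refine Finset.sum_congr rfl fun i hi => ?_
  rw [mvfderiv_mlieBracket hU (hf i hi) hX hY hx, curvature]
  module

/-- The curvature of a torsion-free derivative operator is linear over the scalar fields in its
second argument; the derivatives of the coefficients cancel once `[X, Y]` is written as
`∇_X Y - ∇_Y X`. -/
theorem curvature_sum_smul_second (hT : D.torsion = 0) {ι : Type*} (s : Finset ι) {X Z : VField M}
    {U : Set M} (hU : IsOpen U) (hX : SmoothVFieldOn X U) (hZ : SmoothVFieldOn Z U)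
    {f : ι → M → ℝ} {Y : ι → VField M} (hf : ∀ i ∈ s, ContMDiffOn (𝓡 4) 𝓘(ℝ, ℝ) ∞ (f i) U)
    (hY : ∀ i ∈ s, SmoothVFieldOn (Y i) U) {x : M} (hx : x ∈ U) :
    curvature D X (fun y => ∑ i ∈ s, f i y • Y i y) Z x =
      ∑ i ∈ s, f i x • curvature D X (Y i) Z x := by
  have hS : SmoothVFieldOn (fun y => ∑ i ∈ s, f i y • Y i y) U :=
    SmoothVFieldOn.sum (X := fun i y => f i y • Y i y) fun i hi => (hY i hi).smul (hf i hi)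
  have h1 : (fun y => D Z y (∑ i ∈ s, f i y • Y i y)) =
      fun y => ∑ i ∈ s, f i y • D Z y (Y i y) := by
    ext1 y
    simp only [map_sum, map_smul]
  rw [curvature, h1, mlieBracket_eq_nabla_sub hT (hX.mdiffAt hU hx) (hS.mdiffAt hU hx),
    nabla_sum_smul D s (fun i hi => (hf i hi).mdiffAt hU hx)
    (fun i hi => (hY i hi).mdiffAt hU hx),
    nabla_sum_smul D s (X := fun i y => D Z y (Y i y)) (fun i hi => (hf i hi).mdiffAt hU hx)
    (fun i hi => (hZ.nabla hD (hY i hi) hU).mdiffAt hU hx)]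
  simp only [map_sum, map_smul, ← Finset.sum_sub_distrib, map_add, map_sub]
  refine Finset.sum_congr rfl fun i hi => ?_
  rw [curvature, mlieBracket_eq_nabla_sub hT (hX.mdiffAt hU hx) ((hY i hi).mdiffAt hU hx), map_sub]
  module

/-- The contraction of the Ricci tensor with a vector field `X` is the trace of
`v ↦ R(v, X) X`. -/
theorem sum_ricci_mul (hT : D.torsion = 0) {X : VField M} {x : M} {U : Set M} (hU : IsOpen U)
    (hX : SmoothVFieldOn X U) (hx : x ∈ U) :
    ∑ j, ∑ k, ricci D x j k * (dxField x j x (X x) * dxField x k x (X x)) =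
      ∑ i, dxField x i x (curvature D (partialField x i) X X x) := by
  set V := U ∩ (chartAt R4 x).source
  have hV : IsOpen V := hU.inter (chartAt R4 x).open_source
  have hxV : x ∈ V := ⟨hx, mem_chart_source R4 x⟩
  have hXV : SmoothVFieldOn X V := hX.mono inter_subset_left
  have hE (i : Fin 4) : SmoothVFieldOn (partialField x i) V :=
    (smoothVFieldOn_partialField x i).mono inter_subset_right
  have hc (i : Fin 4) : ContMDiffOn (𝓡 4) 𝓘(ℝ, ℝ) ∞ (fun y => dxField x i y (X y)) V :=
    hXV.dxField hV inter_subset_right i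
  have hsum : ∀ y ∈ V, ∑ i, dxField x i y (X y) • partialField x i y = X y := fun y hy =>
    sum_dxField_smul_partialField hy.2 (X y)
  have hcurv (i : Fin 4) : curvature D (partialField x i) X X x =
      ∑ j, dxField x j x (X x) • ∑ k, dxField x k x (X x) •
        curvature D (partialField x i) (partialField x k) (partialField x j) x := by
    rw [curvature_congr hD hV (hE i) hXV hXV (fun y hy => rfl) hsum hxV,
      curvature_sum_smul_third hD Finset.univ hV (hE i) hXV (fun j _ => hc j) (fun j _ => hE j) hxV]
    refine Finset.sum_congr rfl fun j _ => ?_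
    rw [curvature_congr hD hV (hE i) hXV (hE j) hsum (fun y hy => rfl) hxV,
      curvature_sum_smul_second hD hT Finset.univ hV (hE i) (hE j) (fun j _ => hc j)
        (fun j _ => hE j) hxV]
  simp only [hcurv, map_sum, map_smul, smul_eq_mul, ricci, Finset.sum_mul, Finset.mul_sum]
  conv_rhs => rw [Finset.sum_comm]
  refine Finset.sum_congr rfl fun j _ => ?_
  rw [Finset.sum_comm]
  exact Finset.sum_congr rfl fun i _ => Finset.sum_congr rfl fun k _ => by ring

/-- The Raychaudhuri equation for a geodesic vector field: since `∇_X X = 0`, the trace of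
`v ↦ R(v, X) X` is `- X(θ) - tr (∇X ∘ ∇X)`, up to terms in `∇_X ∂_i` which cancel in the trace. -/
theorem raychaudhuri (hT : D.torsion = 0) {X : VField M} {x : M} {U : Set M} (hU : IsOpen U)
    (hX : SmoothVFieldOn X U) (hgeo : ∀ y ∈ U, D X y (X y) = 0) (hx : x ∈ U) :
    mvfderiv (𝓡 4) (expansion D X) x (X x) =
      - LinearMap.trace ℝ (Tan x) ((D X x).toLinearMap ∘ₗ (D X x).toLinearMap) -
      ∑ j, ∑ k, ricci D x j k * (dxField x j x (X x) * dxField x k x (X x)) := by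
  rw [sum_ricci_mul hD hT hU hX hx]
  set V := U ∩ (chartAt R4 x).source
  have hV : IsOpen V := hU.inter (chartAt R4 x).open_source
  have hxV : x ∈ V := ⟨hx, mem_chart_source R4 x⟩
  have hXV : SmoothVFieldOn X V := hX.mono inter_subset_left
  have hE (i : Fin 4) : SmoothVFieldOn (partialField x i) V :=
    (smoothVFieldOn_partialField x i).mono inter_subset_right
  have hDE (i : Fin 4) := hXV.nabla hD (hE i) hV
  -- the components of `∇ X`
  set a : Fin 4 → Fin 4 → M → ℝ := fun m i y => dxField x m y (D X y (partialField x i y)) with ha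
  have hasm (m i : Fin 4) : ContMDiffOn (𝓡 4) 𝓘(ℝ, ℝ) ∞ (a m i) V :=
    (hDE i).dxField hV inter_subset_right m
  have hθ : mvfderiv (𝓡 4) (expansion D X) x (X x) =
      ∑ i, mvfderiv (𝓡 4) (a i i) x (X x) := by
    rw [← mvfderiv_sum Finset.univ fun i _ => (hasm i i).mdiffAt hV hxV]
    rw [mvfderiv_congr (eventually_of_mem (hV.mem_nhds hxV) fun y hy => expansion_eq_sum D X hy.2)]
  have h1 (i : Fin 4) : curvature D (partialField x i) X X x =
      - D (fun y => D X y (partialField x i y)) x (X x) -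
        D X x (D X x (partialField x i x)) + D X x (D (partialField x i) x (X x)) := by
    have h0 : D (fun y => D X y (X y)) x = 0 := by
      have h00 := D.isCovariantDerivativeOnUniv.zero (x := x)
      rw [← h00]
      exact nabla_congr D ((hXV.nabla hD hXV hV).mdiffAt hV hxV)
        (mdifferentiableAt_zeroSection ..)
        (eventually_of_mem (hV.mem_nhds hxV) fun y hy => hgeo y hy.1)
    rw [curvature, h0, mlieBracket_eq_nabla_sub hT ((hE i).mdiffAt hV hxV) (hXV.mdiffAt hV hxV),
      map_sub, zero_apply]
    module
  have h2 (i : Fin 4) : dxField x i x (D (fun y => D X y (partialField x i y)) x (X x)) =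
      ∑ m, a m i x * dxField x i x (D (partialField x m) x (X x)) +
        mvfderiv (𝓡 4) (a i i) x (X x) := by
    have he : ∀ y ∈ V, D X y (partialField x i y) = ∑ m, a m i y • partialField x m y :=
      fun y hy => (sum_dxField_smul_partialField hy.2 _).symm
    have h3 : D (fun y => D X y (partialField x i y)) x =
        D (fun y => ∑ m, a m i y • partialField x m y) x :=
      nabla_congr D ((hDE i).mdiffAt hV hxV)
        (mdiffAt_congr ((hDE i).mdiffAt hV hxV)
          (eventually_of_mem (hV.mem_nhds hxV) fun y hy => (he y hy).symm))
        (eventually_of_mem (hV.mem_nhds hxV) he)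
    rw [h3, nabla_sum_smul D _ (fun m _ => (hasm m i).mdiffAt hV hxV)
      fun m _ => (hE m).mdiffAt hV hxV]
    simp only [map_sum, map_add, map_smul, smul_eq_mul, dxField_partialField hxV.2,
      Finset.sum_add_distrib]
    simp
  have h3 (i : Fin 4) : dxField x i x (D X x (D (partialField x i) x (X x))) =
      ∑ m, dxField x m x (D (partialField x i) x (X x)) * a i m x := by
    conv_lhs => rw [← sum_dxField_smul_partialField hxV.2 (D (partialField x i) x (X x))]
    simp only [map_sum, map_smul, smul_eq_mul, ha]
  rw [trace_eq_sum hxV.2, hθ]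
  simp only [h1, map_add, map_sub, map_neg, h2, h3, Finset.sum_add_distrib, Finset.sum_sub_distrib,
    Finset.sum_neg_distrib]
  have h4 : ∑ i, ∑ m, a m i x * dxField x i x (D (partialField x m) x (X x)) =
      ∑ i, ∑ m, dxField x m x (D (partialField x i) x (X x)) * a i m x := by
    rw [Finset.sum_comm]
    exact Finset.sum_congr rfl fun i _ => Finset.sum_congr rfl fun m _ => mul_comm _ _
  rw [h4]
  simp only [LinearMap.comp_apply, ContinuousLinearMap.coe_coe]
  ring

end TorsionFree

/-! ### Covector fields and divergences -/

theorem sum_apply_partialField_smul_dxField {x₀ x : M} (hx : x ∈ (chartAt R4 x₀).source)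
    (α : Cotan x) : ∑ j, α (partialField x₀ j x) • dxField x₀ j x = α := by
  ext v
  conv_rhs => rw [← sum_dxField_smul_partialField hx v]
  simp [mul_comm]

/-- The Leibniz rule for the pairing of a covector field with a vector field. -/
theorem mvfderiv_pairing (D : Connection M) {α : CovField M} {X : VField M} {x : M} {U : Set M}
    (hU : IsOpen U) (hx : x ∈ U) (hα : ∀ j, DiffFunAt (fun y => α y (partialField x j y)) x)
    (hX : SmoothVFieldOn X U) (v : Tan x) :
    mvfderiv (𝓡 4) (fun y => α y (X y)) x v = nablaCov D α x v (X x) + α x (D X x v) := by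
  set V := U ∩ (chartAt R4 x).source
  have hV : IsOpen V := hU.inter (chartAt R4 x).open_source
  have hxV : x ∈ V := ⟨hx, mem_chart_source R4 x⟩
  have hXV : SmoothVFieldOn X V := hX.mono inter_subset_left
  have hE (i : Fin 4) : SmoothVFieldOn (partialField x i) V :=
    (smoothVFieldOn_partialField x i).mono inter_subset_right
  have hc (i : Fin 4) : ContMDiffOn (𝓡 4) 𝓘(ℝ, ℝ) ∞ (fun y => dxField x i y (X y)) V :=
    hXV.dxField hV inter_subset_right i
  have hsum : ∀ y ∈ V, X y = ∑ i, dxField x i y (X y) • partialField x i y := fun y hy =>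
    (sum_dxField_smul_partialField hy.2 (X y)).symm
  have h1 : mvfderiv (𝓡 4) (fun y => α y (X y)) x v =
      ∑ j, (dxField x j x (X x) * mvfderiv (𝓡 4) (fun y => α y (partialField x j y)) x v +
        α x (partialField x j x) * mvfderiv (𝓡 4) (fun y => dxField x j y (X y)) x v) := by
    have he : (fun y => α y (X y)) =ᶠ[𝓝 x]
        fun y => ∑ j, dxField x j y (X y) * α y (partialField x j y) := by
      filter_upwards [hV.mem_nhds hxV] with y hy
      conv_lhs => rw [hsum y hy]
      simp only [map_sum, map_smul, smul_eq_mul]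
    rw [mvfderiv_congr he, mvfderiv_sum]
    · refine Finset.sum_congr rfl fun j _ => ?_
      rw [mvfderiv_fun_mul ((hc j).mdiffAt hV hxV) (hα j)]
      rfl
    · exact fun j _ => ((hc j).mdiffAt hV hxV).mul (hα j)
  have h2 : D X x v = ∑ j, (dxField x j x (X x) • D (partialField x j) x v +
      mvfderiv (𝓡 4) (fun y => dxField x j y (X y)) x v • partialField x j x) := by
    rw [← nabla_sum_smul D _ (fun j _ => (hc j).mdiffAt hV hxV) fun j _ => (hE j).mdiffAt hV hxV]
    have hev := eventually_of_mem (hV.mem_nhds hxV) hsum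
    rw [nabla_congr D (hXV.mdiffAt hV hxV)
      (mdiffAt_congr (hXV.mdiffAt hV hxV) (hev.mono fun _ h => h.symm)) hev]
  rw [h1, h2, nablaCov]
  simp only [map_sum, map_add, map_smul, smul_eq_mul, FunLike.coe_sum, Finset.sum_apply,
    FunLike.coe_smul, Pi.smul_apply]
  rw [← Finset.sum_add_distrib]
  exact Finset.sum_congr rfl fun j _ => by ring

theorem SmoothCov.diffFunAt {t : CovField M} (ht : SmoothCov t) (x : M) (j : Fin 4) :
    DiffFunAt (fun y => t y (partialField x j y)) x :=
  (ht x j).mdiffAt (chartAt R4 x).open_source (mem_chart_source R4 x)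

theorem diffFunAt_dxField_partialField (x : M) (i j : Fin 4) :
    DiffFunAt (fun y => dxField x i y (partialField x j y)) x :=
  ((smoothVFieldOn_partialField x j).dxField (chartAt R4 x).open_source subset_rfl i).mdiffAt
    (chartAt R4 x).open_source (mem_chart_source R4 x)

/-- The Leibniz rule for the contraction `T^{ab} t_b` with a parallel covector field. -/
theorem sum_mul_nablaBi (D : Connection M) {t : CovField M} {T : BiField M} (ht : SmoothCov t)
    (hT : SmoothBi T) {x : M} {v : Tan x} (hnt : nablaCov D t x v = 0) (i : Fin 4) :
    ∑ j, t x (partialField x j x) * nablaBi D T x v i j =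
      mvfderiv (𝓡 4) (fun y => T y (dxField x i y) (t y)) x v -
        T x (nablaCov D (dxField x i) x v) (t x) := by
  have hO := (chartAt R4 x).open_source
  have hxO := mem_chart_source R4 x
  have hd (j : Fin 4) : DiffFunAt (fun y => T y (dxField x i y) (dxField x j y)) x :=
    (hT x i j).mdiffAt hO hxO
  have h1 : mvfderiv (𝓡 4) (fun y => T y (dxField x i y) (t y)) x v =
      ∑ j, (t x (partialField x j x) *
        mvfderiv (𝓡 4) (fun y => T y (dxField x i y) (dxField x j y)) x v +
        T x (dxField x i x) (dxField x j x) *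
        mvfderiv (𝓡 4) (fun y => t y (partialField x j y)) x v) := by
    have he : (fun y => T y (dxField x i y) (t y)) =ᶠ[𝓝 x]
        fun y => ∑ j, t y (partialField x j y) * T y (dxField x i y) (dxField x j y) := by
      filter_upwards [hO.mem_nhds hxO] with y hy
      conv_lhs => rw [← sum_apply_partialField_smul_dxField hy (t y)]
      simp only [map_sum, map_smul, smul_eq_mul]
    rw [mvfderiv_congr he, mvfderiv_sum]
    · refine Finset.sum_congr rfl fun j _ => ?_
      rw [mvfderiv_fun_mul (ht.diffFunAt x j) (hd j)]
      rfl
    · exact fun j _ => (ht.diffFunAt x j).mul (hd j)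
  -- the contraction of `∇ t = 0` in terms of the covectors `dx^j`
  have h2 : ∑ j, (t x (partialField x j x) • nablaCov D (dxField x j) x v +
      mvfderiv (𝓡 4) (fun y => t y (partialField x j y)) x v • dxField x j x) = 0 := by
    refine (sum_apply_partialField_smul_dxField hxO _).symm.trans
      (Finset.sum_eq_zero fun k _ => ?_)
    have h3 := mvfderiv_pairing D hO hxO (ht.diffFunAt x) (smoothVFieldOn_partialField x k) v
    rw [hnt] at h3
    have h4 (j : Fin 4) : nablaCov D (dxField x j) x v (partialField x k x) =
        - dxField x j x (D (partialField x k) x v) := by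
      have h5 := mvfderiv_pairing D hO hxO (diffFunAt_dxField_partialField x j)
        (smoothVFieldOn_partialField x k) v
      have h6 : (fun y => dxField x j y (partialField x k y)) =ᶠ[𝓝 x]
          fun _ => if j = k then (1 : ℝ) else 0 :=
        eventually_of_mem (hO.mem_nhds hxO) fun y hy => dxField_partialField hy j k
      rw [mvfderiv_congr h6, mvfderiv_const] at h5
      have h7 : (0 : Tan x →L[ℝ] ℝ) v = 0 := rfl
      rw [h7] at h5
      linarith
    have h8 : t x (D (partialField x k) x v) =
        ∑ j, t x (partialField x j x) * dxField x j x (D (partialField x k) x v) := by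
      conv_lhs => rw [← sum_dxField_smul_partialField hxO (D (partialField x k) x v)]
      simp only [map_sum, map_smul, smul_eq_mul, mul_comm]
    have h9 : (0 : Cotan x) (partialField x k x) = 0 := rfl
    refine (congrArg (fun c : ℝ => c • dxField x k x) ?_).trans (zero_smul _ _)
    simp only [FunLike.coe_sum, Finset.sum_apply, FunLike.coe_add, Pi.add_apply, FunLike.coe_smul,
      Pi.smul_apply, smul_eq_mul, h4, dxField_partialField hxO, Finset.sum_add_distrib]
    rw [h9, h8] at h3
    simp [h3]
  have h8 := congrArg (T x (dxField x i x)) h2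
  simp only [map_sum, map_add, map_smul, smul_eq_mul, map_zero, Finset.sum_add_distrib] at h8
  have h9 : T x (nablaCov D (dxField x i) x v) (t x) =
      ∑ j, t x (partialField x j x) * T x (nablaCov D (dxField x i) x v) (dxField x j x) := by
    conv_lhs => rw [← sum_apply_partialField_smul_dxField hxO (t x)]
    simp only [map_sum, map_smul, smul_eq_mul]
  rw [h1, h9]
  simp only [nablaBi, mul_sub, Finset.sum_sub_distrib, Finset.sum_add_distrib]
  simp only [mul_comm] at h8 ⊢
  linarith

/-- If `T^{ab} t_b = F ξ^a` with `∇_a t_b = 0`, then `t_b ∇_a T^{ab} = ξ^a ∇_a F + F ∇_a ξ^a`. -/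
theorem sum_mul_divBi (D : Connection M) {t : CovField M} {T : BiField M} (ht : SmoothCov t)
    (hT : SmoothBi T) {x : M} (hnt : ∀ v, nablaCov D t x v = 0) {ξ : VField M}
    (hξ : SmoothVFieldOn ξ univ) {F : M → ℝ} (hF : DiffFunAt F x)
    (hTt : ∀ y, ∀ α : Cotan y, T y α (t y) = F y * α (ξ y)) :
    ∑ j, t x (partialField x j x) * divBi D T x j =
      mvfderiv (𝓡 4) F x (ξ x) + F x * expansion D ξ x := by
  have hO := (chartAt R4 x).open_source
  have hxO := mem_chart_source R4 x
  have h1 (i : Fin 4) (v : Tan x) : ∑ j, t x (partialField x j x) * nablaBi D T x v i j =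
      mvfderiv (𝓡 4) F x v * dxField x i x (ξ x) + F x * dxField x i x (D ξ x v) := by
    have hd : DiffFunAt (fun y => dxField x i y (ξ y)) x :=
      ((hξ.mono (subset_univ _)).dxField hO subset_rfl i).mdiffAt hO hxO
    rw [sum_mul_nablaBi D ht hT (hnt v) i, hTt]
    simp only [hTt]
    rw [mvfderiv_fun_mul hF hd, add_apply]
    have h2 := mvfderiv_pairing D isOpen_univ (mem_univ x) (diffFunAt_dxField_partialField x i) hξ v
    simp only [FunLike.coe_smul, Pi.smul_apply, smul_eq_mul]
    rw [h2]
    ring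
  simp only [divBi, Finset.mul_sum]
  rw [Finset.sum_comm]
  simp only [h1, Finset.sum_add_distrib, ← Finset.mul_sum, ← expansion_eq_sum D ξ hxO]
  conv_rhs => rw [← sum_dxField_smul_partialField hxO (ξ x)]
  simp only [map_sum, map_smul, smul_eq_mul, mul_comm]

/-! ### Linear algebra of isotropy -/

open Polynomial Filter in
/-- A real polynomial of odd degree has a root. -/
theorem exists_isRoot_of_odd_natDegree {p : ℝ[X]} (hp : p.Monic) (hodd : Odd p.natDegree) :
    ∃ x, p.IsRoot x := by
  have h1 : Tendsto (fun x => eval x p) atTop atTop :=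
    p.tendsto_atTop_of_leadingCoeff_nonneg (natDegree_pos_iff_degree_pos.1 hodd.pos)
      (by simp [hp.leadingCoeff])
  have h2 : Tendsto (fun x => eval x (p.comp (-X))) atTop atBot := by
    refine Polynomial.tendsto_atBot_of_leadingCoeff_nonpos _ ?_ ?_
    · rw [← natDegree_pos_iff_degree_pos, natDegree_comp]
      simpa using hodd.pos
    · rw [leadingCoeff_comp (by simp), hp.leadingCoeff]
      simp [hodd.neg_one_pow]
  obtain ⟨a, ha⟩ := (h1.eventually_ge_atTop 0).exists
  obtain ⟨b, hb⟩ := (h2.eventually_le_atBot 0).exists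
  have := mem_range_of_exists_le_of_exists_ge p.continuous ⟨-b, by simpa using hb⟩ ⟨a, ha⟩
  exact this

open Module in
theorem exists_hasEigenvalue_of_odd_finrank {V : Type*} [AddCommGroup V] [Module ℝ V]
    [FiniteDimensional ℝ V] (hodd : Odd (finrank ℝ V)) (A : End ℝ V) :
    ∃ c : ℝ, End.HasEigenvalue A c := by
  obtain ⟨c, hc⟩ := exists_isRoot_of_odd_natDegree A.charpoly_monic
    (by rwa [LinearMap.charpoly_natDegree])
  exact ⟨c, A.hasEigenvalue_iff_isRoot_charpoly c |>.2 hc⟩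

/-- An endomorphism of an odd-dimensional real vector space which commutes with enough linear maps
to move any line into any other is a homothety, since it has a real eigenvalue. -/
theorem exists_eq_smul_of_transitive {V : Type*} [AddCommGroup V] [Module ℝ V]
    [FiniteDimensional ℝ V] (hodd : Odd (Module.finrank ℝ V)) (A : V →ₗ[ℝ] V) (P : V → Prop)
    (hP : ∀ v, v ≠ 0 → ∃ c : ℝ, c ≠ 0 ∧ P (c • v))
    (hA : ∀ v w, P v → P w → ∃ g : V →ₗ[ℝ] V, g v = w ∧ ∀ u, A (g u) = g (A u)) :
    ∃ c : ℝ, ∀ v, A v = c • v := by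
  obtain ⟨c, hc⟩ := exists_hasEigenvalue_of_odd_finrank hodd A
  obtain ⟨v, hv⟩ := hc.exists_hasEigenvector
  obtain ⟨a, ha, hav⟩ := hP v hv.2
  refine ⟨c, fun w => ?_⟩
  by_cases hw : w = 0
  · simp [hw]
  obtain ⟨b, hb, hbw⟩ := hP w hw
  obtain ⟨g, hg, hgA⟩ := hA _ _ hav hbw
  have h1 : A (b • w) = c • b • w := by
    rw [← hg, hgA, map_smul A, hv.apply_eq_smul, smul_comm a c v, map_smul g c]
  rw [map_smul, smul_comm c b w] at h1
  exact smul_right_injective V hb h1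

/-- An endomorphism of a four-dimensional space which kills a vector off a hyperplane and is a
homothety of the hyperplane satisfies `tr (A ∘ A) = (tr A)² / 3`. -/
theorem trace_comp_self_of_homothety {V : Type*} [AddCommGroup V] [Module ℝ V]
    [FiniteDimensional ℝ V] (hV : Module.finrank ℝ V = 4) (A : V →ₗ[ℝ] V) (t : V →ₗ[ℝ] ℝ) (e : V)
    (hte : t e ≠ 0) (hAe : A e = 0) (c : ℝ) (hc : ∀ v, t v = 0 → A v = c • v) :
    LinearMap.trace ℝ V (A ∘ₗ A) = LinearMap.trace ℝ V A ^ 2 / 3 := by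
  have hA (v : V) : A v = c • v - (c * (t e)⁻¹ * t v) • e := by
    have h1 := hc (v - ((t e)⁻¹ * t v) • e) (by simp; field_simp; ring)
    rw [map_sub, map_smul, hAe, smul_zero, sub_zero] at h1
    rw [h1]
    module
  have hA' : A = c • LinearMap.id - (c * (t e)⁻¹) • t.smulRight e := by
    ext v
    rw [hA v]
    simp [mul_smul]
  have hAA : A ∘ₗ A = c • A := by
    ext v
    have h1 : t (A v) = 0 := by
      rw [hA v]
      simp
      field_simp
      ring
    rw [LinearMap.comp_apply, hc _ h1, LinearMap.smul_apply]
  have htr : LinearMap.trace ℝ V A = 3 * c := by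
    rw [hA', map_sub, map_smul, map_smul, LinearMap.trace_id, hV, LinearMap.trace_smulRight]
    simp only [smul_eq_mul]
    field_simp
    norm_num
  rw [hAA, map_smul, htr, smul_eq_mul]
  ring

/-! ### Isotropy at a point -/

instance (x : M) : FiniteDimensional ℝ (Tan x) :=
  Module.Finite.of_basis (coordBasis (mem_chart_source R4 x))

theorem finrank_tan (x : M) : Module.finrank ℝ (Tan x) = 4 := by
  rw [Module.finrank_eq_card_basis (coordBasis (mem_chart_source R4 x)), Fintype.card_fin]

section Isotropy

variable {t : CovField M} {h : BiField M} {D : Connection M} {ξ : VField M}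

omit [IsManifold (𝓡 4) ∞ M] in
theorem IsUnitSpacelike.neg {x : M} {v : Tan x} (hv : IsUnitSpacelike t h x v) :
    IsUnitSpacelike t h x (-v) := by
  obtain ⟨h1, σ, h2, h3⟩ := hv
  refine ⟨by simpa [IsTimelike] using h1, -σ, fun β => ?_, ?_⟩
  · rw [map_neg, map_neg, h2]
  · simp [h3]

/-- Every nonzero vector annihilated by `t` is proportional to a unit spacelike vector. -/
theorem IsClassicalSpacetime.exists_isUnitSpacelike_smul (hst : IsClassicalSpacetime t h D) {x : M}
    {v : Tan x} (hv : v ≠ 0) (htv : t x v = 0) :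
    ∃ c : ℝ, c ≠ 0 ∧ IsUnitSpacelike t h x (c • v) := by
  obtain ⟨b, hb⟩ := hst.h_signature x
  -- `t` is proportional to `b 0`
  have ht (i : Fin 4) (hi : i ≠ 0) : b.repr (t x) i = 0 := by
    have h1 := hst.h_t x (b i)
    have h2 : h x (b i) (∑ j, b.repr (t x) j • b j) = b.repr (t x) i := by
      simp only [map_sum, map_smul, hb, smul_eq_mul]
      simp [hi]
    rw [← h2, b.sum_repr, h1]
  have ht0 : t x = b.repr (t x) 0 • b 0 := by
    conv_lhs => rw [← b.sum_repr (t x)]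
    exact Finset.sum_eq_single 0 (fun i _ hi => by rw [ht i hi, zero_smul]) (by simp)
  have hb0 : b 0 v = 0 := by
    have h1 : b.repr (t x) 0 ≠ 0 := fun h0 => hst.t_ne_zero x (by rw [ht0, h0, zero_smul])
    rw [ht0] at htv
    simpa [h1] using htv
  -- so `Σ b_i(v) b_i` is a covector which `h` raises to `v`
  have hσ (β : Cotan x) : h x β (∑ i, b i v • b i) = β v := by
    conv_lhs => rw [← b.sum_repr β]
    conv_rhs => rw [← b.sum_repr β]
    simp only [map_sum, map_smul, LinearMap.sum_apply, LinearMap.smul_apply, hb, FunLike.coe_sum,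
      Finset.sum_apply, FunLike.coe_smul, Pi.smul_apply, smul_eq_mul]
    simp [Fin.sum_univ_four, hb0]
    ring
  have hpos : 0 < ∑ i, b i v * b i v := by
    refine (Finset.sum_nonneg fun i _ => mul_self_nonneg _).lt_of_ne' fun h0 => hv ?_
    have h1 := (Finset.sum_eq_zero_iff_of_nonneg fun i _ => mul_self_nonneg _).1 h0
    -- the coordinates `dx^i` of `v` vanish because all covectors do
    have h2 (β : Cotan x) : β v = 0 := by
      rw [← b.sum_repr β, FunLike.coe_sum, Finset.sum_apply]
      exact Finset.sum_eq_zero fun i _ => by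
        rw [FunLike.coe_smul, Pi.smul_apply, mul_self_eq_zero.1 (h1 i (Finset.mem_univ i)),
          smul_zero]
    rw [← sum_dxField_smul_partialField (mem_chart_source R4 x) v]
    exact Finset.sum_eq_zero fun i _ => by rw [h2, zero_smul]
  have hnorm : h x (∑ i, b i v • b i) (∑ i, b i v • b i) = ∑ i, b i v * b i v := by
    rw [hσ]
    simp
  set s := Real.sqrt (∑ i, b i v * b i v)
  have hs : 0 < s := Real.sqrt_pos.2 hpos
  have hss : s * s = ∑ i, b i v * b i v := Real.mul_self_sqrt hpos.le
  refine ⟨s⁻¹, inv_ne_zero hs.ne', by simp [IsTimelike, htv], s⁻¹ • ∑ i, b i v • b i,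
    fun β => ?_, ?_⟩
  · rw [map_smul, map_smul, hσ]
  · rw [map_smul, map_smul, LinearMap.smul_apply, hnorm, ← hss]
    simp only [smul_eq_mul]
    field_simp

/-- The differential at `p` of an isometry which moves `μ` to `ν` is a linear map of the tangent
space at `p` that preserves `t`, `ξ` and `∇ξ`. -/
theorem IsHomogeneousIsotropic.exists_linearMap (hiso : IsHomogeneousIsotropic t h D ξ)
    (hξ : SmoothVFieldOn ξ univ) {p : M} {μ ν : Tan p} (hμ : IsUnitSpacelike t h p μ)
    (hν : IsUnitSpacelike t h p ν) :
    ∃ g : Tan p →ₗ[ℝ] Tan p, g μ = ν ∧ g (ξ p) = ξ p ∧ (∀ v, t p (g v) = t p v) ∧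
      ∀ v, D ξ p (g v) = g (D ξ p v) := by
  obtain ⟨φ, hp, -, hφ, hφξ, hφμ⟩ := hiso p μ ν hμ hν
  have h1 := hφξ p hp
  have h2 := hφ.map_t p hp
  have h3 := hφ.map_D ξ ξ (hξ.mono (subset_univ _)) (hξ.mono (subset_univ _)) hφξ p hp
  rw [tangentMap] at hφμ
  simp only at hφμ
  generalize mfderiv (𝓡 4) (𝓡 4) φ p = L at *
  generalize φ p = q at *
  obtain ⟨rfl, h4⟩ := Bundle.TotalSpace.mk.inj hφμ
  exact ⟨L.toLinearMap, eq_of_heq h4, h1, h2, h3⟩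

end Isotropy

section Isotropy

variable {t : CovField M} {h : BiField M} {D : Connection M} {ξ : VField M} {p : M}

/-- Isotropy excludes a spatial acceleration: it would be fixed by all isometries, among them one
which reverses it. -/
theorem nabla_self_eq_zero (hst : IsClassicalSpacetime t h D)
    (hiso : IsHomogeneousIsotropic t h D ξ) (hξ : SmoothVFieldOn ξ univ)
    (hA : ∀ v, t p (D ξ p v) = 0) : D ξ p (ξ p) = 0 := by
  by_contra hw
  obtain ⟨c, hc, hu⟩ := hst.exists_isUnitSpacelike_smul hw (hA _)
  obtain ⟨g, hg, hgξ, -, hgA⟩ := hiso.exists_linearMap hξ hu hu.neg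
  have h1 : g (D ξ p (ξ p)) = D ξ p (ξ p) := by rw [← hgA, hgξ]
  rw [map_smul, h1, ← smul_neg] at hg
  have h2 := smul_right_injective _ hc hg
  have h3 : (2 : ℝ) • D ξ p (ξ p) = 0 := by
    rw [two_smul]
    exact add_eq_zero_iff_eq_neg.2 h2
  exact hw ((smul_eq_zero.1 h3).resolve_left two_ne_zero)

/-- Isotropy excludes shear and vorticity: `∇ ξ` is a homothety on spacelike vectors. -/
theorem exists_nabla_eq_smul (hst : IsClassicalSpacetime t h D)
    (hiso : IsHomogeneousIsotropic t h D ξ) (hξ : SmoothVFieldOn ξ univ)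
    (hA : ∀ v, t p (D ξ p v) = 0) : ∃ c : ℝ, ∀ v, t p v = 0 → D ξ p v = c • v := by
  set K := LinearMap.ker (t p).toLinearMap
  have hK : Module.finrank ℝ K = 3 := by
    have h0 : (t p).toLinearMap ≠ 0 := fun h0 => hst.t_ne_zero p (by ext v; exact congr($h0 v))
    have h1 := Module.Dual.finrank_ker_add_one_of_ne_zero h0
    rw [finrank_tan] at h1
    exact Nat.succ.inj h1
  set A : K →ₗ[ℝ] K := (D ξ p).toLinearMap.restrict fun v _ => hA v
  obtain ⟨c, hc⟩ := exists_eq_smul_of_transitive (by rw [hK]; decide) A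
    (fun v => IsUnitSpacelike t h p (v : Tan p))
    (fun v hv => hst.exists_isUnitSpacelike_smul (by simpa using hv) v.2)
    (fun v w hv hw => by
      obtain ⟨g, hg, -, hgt, hgA⟩ := hiso.exists_linearMap hξ hv hw
      refine ⟨g.restrict fun u hu => (hgt u).trans hu, Subtype.ext hg, fun u => Subtype.ext ?_⟩
      exact hgA u)
  exact ⟨c, fun v hv => congrArg Subtype.val (hc ⟨v, hv⟩)⟩

/-- Without shear, vorticity and acceleration, `∇_a ξ^b ∇_b ξ^a = θ² / 3`. -/
theorem trace_nabla_comp_nabla (hst : IsClassicalSpacetime t h D)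
    (hiso : IsHomogeneousIsotropic t h D ξ) (hξ : SmoothVFieldOn ξ univ) (htξ : t p (ξ p) ≠ 0)
    (hA : ∀ v, t p (D ξ p v) = 0) :
    LinearMap.trace ℝ (Tan p) ((D ξ p).toLinearMap ∘ₗ (D ξ p).toLinearMap) =
      expansion D ξ p ^ 2 / 3 := by
  obtain ⟨c, hc⟩ := exists_nabla_eq_smul hst hiso hξ hA
  exact trace_comp_self_of_homothety (finrank_tan p) (D ξ p).toLinearMap (t p).toLinearMap (ξ p)
    htξ (nabla_self_eq_zero hst hiso hξ hA) c hc

end Isotropy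

/-! ### The evolution of the density and of the expansion -/

theorem SmoothCov.pairing {t : CovField M} (ht : SmoothCov t) {X : VField M}
    (hX : SmoothVFieldOn X univ) : ContMDiff (𝓡 4) 𝓘(ℝ, ℝ) ∞ fun x => t x (X x) := by
  intro x
  have hO := (chartAt R4 x).open_source
  have h1 : ContMDiffOn (𝓡 4) 𝓘(ℝ, ℝ) ∞
      (fun y => ∑ j, dxField x j y (X y) * t y (partialField x j y)) (chartAt R4 x).source :=
    contMDiffOn_finsetSum fun j _ =>
      ((hX.mono (subset_univ _)).dxField hO subset_rfl j).mul (ht x j)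
  refine (h1.congr fun y hy => ?_).contMDiffAt (hO.mem_nhds (mem_chart_source R4 x))
  conv_lhs => rw [← sum_dxField_smul_partialField hy (X y)]
  simp only [map_sum, map_smul, smul_eq_mul]

theorem contMDiff_massDensity {t : CovField M} (ht : SmoothCov t) {T : BiField M}
    (hT : SmoothBi T) : ContMDiff (𝓡 4) 𝓘(ℝ, ℝ) ∞ (massDensity t T) := by
  intro x
  have hO := (chartAt R4 x).open_source
  have h1 : ContMDiffOn (𝓡 4) 𝓘(ℝ, ℝ) ∞
      (fun y => ∑ j, t y (partialField x j y) * ∑ i, t y (partialField x i y) *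
        T y (dxField x i y) (dxField x j y)) (chartAt R4 x).source :=
    contMDiffOn_finsetSum fun j _ => (ht x j).mul
      (contMDiffOn_finsetSum fun i _ => (ht x i).mul (hT x i j))
  refine (h1.congr fun y hy => ?_).contMDiffAt (hO.mem_nhds (mem_chart_source R4 x))
  rw [massDensity]
  conv_lhs => rw [← sum_apply_partialField_smul_dxField hy (t y)]
  simp only [map_sum, map_smul, smul_eq_mul, LinearMap.sum_apply, LinearMap.smul_apply]

section FLRW

variable {t : CovField M} {h : BiField M} {D : Connection M} {ξ : VField M} {T : BiField M}
  (hF : IsFLRWLike t h D ξ T)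

include hF

/-- `T^{ab} t_b = ρ (t_c ξ^c) ξ^a`. -/
theorem IsFLRWLike.apply_t (x : M) (α : Cotan x) :
    T x α (t x) = massDensity t T x * t x (ξ x) * α (ξ x) := by
  obtain ⟨p, -, hp⟩ := hF.perfect_fluid
  rw [hp, hF.spacetime.h_t]
  ring

/-- Where there is mass, the velocity field is a unit field. -/
theorem IsFLRWLike.t_mul_t {x : M} (hx : massDensity t T x ≠ 0) : t x (ξ x) * t x (ξ x) = 1 := by
  have h1 := hF.apply_t x (t x)
  rw [← massDensity, mul_assoc] at h1
  exact mul_left_cancel₀ hx (by linarith)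

/-- Where there is mass, `t_a ξ^a` is locally constant. -/
theorem IsFLRWLike.eventually_t_eq {x : M} (hx : massDensity t T x ≠ 0) :
    ∀ᶠ y in 𝓝 x, t y (ξ y) = t x (ξ x) := by
  have hc := (hF.spacetime.smooth_t.pairing hF.smooth_ξ).continuous
  have hρ := (contMDiff_massDensity hF.spacetime.smooth_t hF.smooth_T).continuous
  have h1 := hF.t_mul_t hx
  have h2 : ∀ᶠ y in 𝓝 x, t y (ξ y) * t x (ξ x) > 0 :=
    ((hc.mul continuous_const).tendsto x).eventually_const_lt (by
      show 0 < t x (ξ x) * t x (ξ x)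
      rw [h1]; exact one_pos)
  filter_upwards [h2, hρ.continuousAt.eventually_ne hx] with y hy hy'
  have h3 := hF.t_mul_t hy'
  rcases mul_self_eq_one_iff.1 h1 with h | h <;> rcases mul_self_eq_one_iff.1 h3 with h' | h' <;>
    rw [h, h'] at hy ⊢ <;> norm_num at hy

/-- Where there is mass, the derivatives of the velocity field are spacelike. -/
theorem IsFLRWLike.t_nabla {x : M} (hx : massDensity t T x ≠ 0) (v : Tan x) :
    t x (D ξ x v) = 0 := by
  have h1 := mvfderiv_pairing D isOpen_univ (mem_univ x) (hF.spacetime.smooth_t.diffFunAt x)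
    hF.smooth_ξ v
  rw [hF.spacetime.nabla_t, mvfderiv_congr (hF.eventually_t_eq hx), mvfderiv_const] at h1
  have h2 : (0 : Cotan x) (ξ x) = 0 := rfl
  have h3 : (0 : Tan x →L[ℝ] ℝ) v = 0 := rfl
  linarith

/-- Where there is mass, the velocity field is geodesic. -/
theorem IsFLRWLike.nabla_self {x : M} (hx : massDensity t T x ≠ 0) : D ξ x (ξ x) = 0 :=
  nabla_self_eq_zero hF.spacetime hF.isotropic hF.smooth_ξ (hF.t_nabla hx)

/-- The continuity equation `ξ^a ∇_a ρ = - ρ θ`. -/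
theorem IsFLRWLike.mvfderiv_massDensity (hcons : ConservationCondition D T) {x : M}
    (hx : massDensity t T x ≠ 0) :
    mvfderiv (𝓡 4) (massDensity t T) x (ξ x) = - (expansion D ξ x * massDensity t T x) := by
  have hρ : DiffFunAt (massDensity t T) x :=
    (contMDiff_massDensity hF.spacetime.smooth_t hF.smooth_T).mdifferentiable (by simp) x
  have hs : DiffFunAt (fun y => t y (ξ y)) x :=
    (hF.spacetime.smooth_t.pairing hF.smooth_ξ).mdifferentiable (by simp) x
  have h1 := sum_mul_divBi D hF.spacetime.smooth_t hF.smooth_T (hF.spacetime.nabla_t x)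
    hF.smooth_ξ (hρ.mul hs) hF.apply_t
  simp only [hcons x, mul_zero, Finset.sum_const_zero] at h1
  rw [mvfderiv_mul hρ hs, mvfderiv_congr (f := fun y => t y (ξ y)) (hF.eventually_t_eq hx),
    mvfderiv_const] at h1
  have h2 : t x (ξ x) * (mvfderiv (𝓡 4) (massDensity t T) x (ξ x) +
      expansion D ξ x * massDensity t T x) = 0 := by
    have h3 : (massDensity t T x • (0 : Tan x →L[ℝ] ℝ) +
        t x (ξ x) • mvfderiv (𝓡 4) (massDensity t T) x) (ξ x) =
        t x (ξ x) * mvfderiv (𝓡 4) (massDensity t T) x (ξ x) := by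
      simp
    rw [h3] at h1
    simp only [Pi.mul_apply] at h1
    linarith
  have h4 : t x (ξ x) ≠ 0 := fun h => by simpa [h] using hF.t_mul_t hx
  linarith [(mul_eq_zero.1 h2).resolve_left h4]

/-- The Raychaudhuri equation `ξ^a ∇_a θ = - θ² / 3 - 4 π ρ`. -/
theorem IsFLRWLike.mvfderiv_expansion [T2Space M] {x : M} (hx : massDensity t T x ≠ 0) :
    mvfderiv (𝓡 4) (expansion D ξ) x (ξ x) =
      - (expansion D ξ x ^ 2 / 3) - 4 * Real.pi * massDensity t T x := by
  have hρ := (contMDiff_massDensity hF.spacetime.smooth_t hF.smooth_T).continuous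
  have hU : IsOpen {y | massDensity t T y ≠ 0} := isOpen_ne_fun hρ continuous_const
  have hxO := mem_chart_source R4 x
  rw [raychaudhuri hF.spacetime.smooth_D hF.spacetime.torsion_free hU
    (hF.smooth_ξ.mono (subset_univ _)) (fun y hy => hF.nabla_self hy) hx,
    trace_nabla_comp_nabla hF.spacetime hF.isotropic hF.smooth_ξ
      (fun h => by simpa [h] using hF.t_mul_t hx) (hF.t_nabla hx)]
  have h1 : t x (ξ x) = ∑ j, dxField x j x (ξ x) * t x (partialField x j x) := by
    conv_lhs => rw [← sum_dxField_smul_partialField hxO (ξ x)]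
    simp only [map_sum, map_smul, smul_eq_mul]
  have h2 : ∑ j, ∑ k, ricci D x j k * (dxField x j x (ξ x) * dxField x k x (ξ x)) =
      4 * Real.pi * massDensity t T x * (t x (ξ x) * t x (ξ x)) := by
    rw [h1, Finset.sum_mul_sum, Finset.mul_sum]
    refine Finset.sum_congr rfl fun j _ => ?_
    rw [Finset.mul_sum]
    refine Finset.sum_congr rfl fun k _ => ?_
    rw [hF.poisson]
    ring
  rw [h2, hF.t_mul_t hx, mul_one]

end FLRW

/-! ### Ordinary differential equations -/

/-- A function with `θ' ≤ - θ² / 3` on all of `ℝ` is nowhere negative. -/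
theorem nonneg_of_riccati {θ θ' : ℝ → ℝ} (hθ : ∀ s, HasDerivAt θ (θ' s) s)
    (hle : ∀ s, θ' s ≤ - (θ s ^ 2 / 3)) (s₀ : ℝ) : 0 ≤ θ s₀ := by
  by_contra! h0
  have hanti : Antitone θ := antitone_of_hasDerivAt_nonpos hθ fun s =>
    (hle s).trans (neg_nonpos.2 (by positivity))
  have hneg : ∀ s ∈ Ici s₀, θ s < 0 := fun s hs => (hanti hs).trans_lt h0
  -- as `(1 / θ)' ≥ 1 / 3`, the function `s / 3 - 1 / θ` is decreasing, so that `1 / θ` would be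
  -- nonnegative at `s₀ - 3 / θ s₀`
  have hd : ∀ s ∈ Ici s₀, HasDerivAt (fun s => s / 3 - (θ s)⁻¹) (1 / 3 - (-θ' s / θ s ^ 2)) s :=
    fun s hs => ((hasDerivAt_id s).div_const 3).sub ((hθ s).inv (hneg s hs).ne)
  have hanti2 : AntitoneOn (fun s => s / 3 - (θ s)⁻¹) (Ici s₀) := by
    refine antitoneOn_of_deriv_nonpos (convex_Ici s₀)
      (fun s hs => (hd s hs).continuousAt.continuousWithinAt)
      (fun s hs => (hd s (interior_subset hs)).differentiableAt.differentiableWithinAt)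
      fun s hs => ?_
    have hs' := interior_subset hs
    have hp : 0 < θ s ^ 2 := sq_pos_of_neg (hneg s hs')
    rw [(hd s hs').deriv, sub_nonpos, div_le_div_iff₀ (by norm_num) hp]
    linarith [hle s]
  have hi : (θ s₀)⁻¹ < 0 := inv_lt_zero.2 h0
  have h1 := hanti2 self_mem_Ici (show s₀ - 3 * (θ s₀)⁻¹ ∈ Ici s₀ by
    simp only [mem_Ici]; linarith) (by linarith)
  have h2 : (θ (s₀ - 3 * (θ s₀)⁻¹))⁻¹ < 0 := inv_lt_zero.2 (hneg _ (by
    simp only [mem_Ici]; linarith))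
  simp only at h1
  linarith

/-- The equation `θ' = - θ² / 3 - k` with `k > 0` has no solution on all of `ℝ`: such a solution and
its time reversal `- θ (- s)` would be nonnegative, hence zero. -/
theorem not_riccati {θ k : ℝ → ℝ} (hθ : ∀ s, HasDerivAt θ (- (θ s ^ 2 / 3) - k s) s)
    (hk : ∀ s, 0 < k s) : False := by
  have h1 := nonneg_of_riccati hθ fun s => by linarith [hk s]
  have h2 := nonneg_of_riccati (θ := fun s => - θ (-s))
    (θ' := fun s => - (θ (-s) ^ 2 / 3) - k (-s))
    (fun s => by
      refine ((hθ (-s)).comp s (hasDerivAt_neg s)).neg.congr_deriv ?_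
      ring)
    fun s => by rw [neg_sq]; linarith [hk (-s)]
  have h3 : ∀ s, θ s = 0 := fun s => le_antisymm (by simpa using h2 (-s)) (h1 s)
  have h4 := (hθ 0).unique ((hasDerivAt_const 0 (0 : ℝ)).congr_of_eventuallyEq
    (Eventually.of_forall h3))
  have h5 := hk 0
  rw [h3] at h4
  linarith

/-- A solution of a linear differential equation which vanishes somewhere vanishes nearby. -/
theorem eventually_eq_zero_of_linear {E : Type*} [NormedAddCommGroup E] [NormedSpace ℝ E]
    {z : ℝ → E} {B : ℝ → E →L[ℝ] E} {s₀ : ℝ} (hB : ContinuousAt B s₀)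
    (hz : ∀ᶠ s in 𝓝 s₀, HasDerivAt z (B s (z s)) s) (h0 : z s₀ = 0) : ∀ᶠ s in 𝓝 s₀, z s = 0 := by
  have hK : ∀ᶠ s in 𝓝 s₀, ‖B s‖₊ < ‖B s₀‖₊ + 1 :=
    hB.nnnorm.eventually_lt_const (lt_add_one _)
  refine ODE_solution_unique_of_eventually (v := fun s e => B s e) (s := fun _ => univ)
    (K := ‖B s₀‖₊ + 1) (t₀ := s₀) (g := fun _ => 0) ?_ (hz.mono fun s hs => ⟨hs, trivial⟩)
    (Eventually.of_forall fun s => ⟨by simpa using hasDerivAt_const s (0 : E), trivial⟩) h0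
  filter_upwards [hK] with s hs
  exact ((B s).lipschitz.weaken hs.le).lipschitzOnWith

/-- An integral curve in a vector space of a smooth vector field is smooth. -/
theorem contDiffOn_of_hasDerivAt {E : Type*} [NormedAddCommGroup E] [NormedSpace ℝ E]
    {u : ℝ → E} {F : E → E} {N : Set ℝ} {W : Set E} (hN : IsOpen N) (hF : ContDiffOn ℝ ∞ F W)
    (huW : MapsTo u N W) (hu : ∀ s ∈ N, HasDerivAt u (F (u s)) s) : ContDiffOn ℝ ∞ u N := by
  refine contDiffOn_infty.2 fun n => ?_
  induction n with
  | zero => exact contDiffOn_zero.2 fun s hs => (hu s hs).continuousAt.continuousWithinAt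
  | succ n ih =>
    rw [Nat.cast_succ, contDiffOn_succ_iff_deriv_of_isOpen hN]
    refine ⟨fun s hs => (hu s hs).differentiableAt.differentiableWithinAt, by simp, ?_⟩
    exact ((hF.of_le (by exact_mod_cast le_top)).comp ih huW).congr fun s hs => (hu s hs).deriv

/-! ### Curves -/

omit [IsManifold (𝓡 4) ∞ M] in
/-- The chain rule for a scalar field along a curve. -/
theorem hasDerivAt_comp_curve {γ : ℝ → M} {s : ℝ} {v : Tan (γ s)} {f : M → ℝ}
    (hf : DiffFunAt f (γ s))
    (hγ : HasMFDerivAt 𝓘(ℝ, ℝ) (𝓡 4) γ s ((1 : ℝ →L[ℝ] ℝ).smulRight v)) :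
    HasDerivAt (fun r => f (γ r)) (mvfderiv (𝓡 4) f (γ s) v) s := by
  have h1 : HasFDerivAt (fun r => f (γ r))
      ((mvfderiv (𝓡 4) f (γ s)).comp ((1 : ℝ →L[ℝ] ℝ).smulRight v)) s :=
    (hf.hasMFDerivAt.comp s hγ).hasFDerivAt
  exact h1.hasDerivAt.congr_deriv (by simp)

/-- The components of the velocity of a curve in a chart. -/
theorem hasDerivAt_chart_comp_curve {γ : ℝ → M} {s : ℝ} {v : Tan (γ s)} {x₀ : M}
    (hs : γ s ∈ (chartAt R4 x₀).source)
    (hγ : HasMFDerivAt 𝓘(ℝ, ℝ) (𝓡 4) γ s ((1 : ℝ →L[ℝ] ℝ).smulRight v)) :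
    HasDerivAt (fun r => extChartAt (𝓡 4) x₀ (γ r)) (coords x₀ (γ s) v) s := by
  have h0 : MDifferentiableAt (𝓡 4) 𝓘(ℝ, R4) (extChartAt (𝓡 4) x₀) (γ s) :=
    mdifferentiableAt_extChartAt hs
  have h1 : HasFDerivAt (fun r => extChartAt (𝓡 4) x₀ (γ r))
      ((coords x₀ (γ s)).comp ((1 : ℝ →L[ℝ] ℝ).smulRight v)) s := by
    rw [coords, TangentBundle.continuousLinearMapAt_trivializationAt hs]
    exact (h0.hasMFDerivAt.comp s hγ).hasFDerivAt
  exact h1.hasDerivAt.congr_deriv (by simp)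

omit [IsManifold (𝓡 4) ∞ M] in
/-- A differentiable curve has its velocity as derivative. -/
theorem hasMFDerivAt_velocity {γ : ℝ → M} {s : ℝ} (hγ : MDifferentiableAt 𝓘(ℝ, ℝ) (𝓡 4) γ s) :
    HasMFDerivAt 𝓘(ℝ, ℝ) (𝓡 4) γ s ((1 : ℝ →L[ℝ] ℝ).smulRight (velocity γ s)) := by
  refine hγ.hasMFDerivAt.congr_mfderiv ?_
  have h1 (L : ℝ →L[ℝ] Tan (γ s)) : L = (1 : ℝ →L[ℝ] ℝ).smulRight (L 1) := by
    ext
    simp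
  exact h1 _

omit [IsManifold (𝓡 4) ∞ M] in
theorem velocity_eq {γ : ℝ → M} {s : ℝ} {v : Tan (γ s)}
    (hγ : HasMFDerivAt 𝓘(ℝ, ℝ) (𝓡 4) γ s ((1 : ℝ →L[ℝ] ℝ).smulRight v)) : velocity γ s = v := by
  rw [velocity, hγ.mfderiv]
  exact one_smul ℝ v

/-! ### Covariant derivatives along curves -/

theorem nabla_coordField (D : Connection M) (x₀ : M) (e : R4) {x : M}
    (hx : x ∈ (chartAt R4 x₀).source) (v : Tan x) :
    D (coordField x₀ e) x v = ∑ k, e k • D (partialField x₀ k) x v := by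
  have hO := (chartAt R4 x₀).open_source
  have h1 : coordField x₀ e = fun y => ∑ k, e k • partialField x₀ k y := by
    ext1 y
    exact coordField_eq_sum x₀ e y
  rw [h1, nabla_sum_smul D _ (f := fun k _ => e k) (fun k _ => mdifferentiableAt_const)
    fun k _ => (smoothVFieldOn_partialField x₀ k).mdiffAt hO hx]
  simp [mvfderiv_const]

/-- The covariant derivative along a curve of a combination of vector fields with coefficients
depending on the parameter; in particular it may be computed in the frame of any chart. -/
theorem nablaAlong_eq_sum (D : Connection M) {γ : ℝ → M} {s : ℝ} {v : Tan (γ s)}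
    {V : (r : ℝ) → Tan (γ r)} {U : Set M} (hU : IsOpen U) (hs : γ s ∈ U)
    (hγ : HasMFDerivAt 𝓘(ℝ, ℝ) (𝓡 4) γ s ((1 : ℝ →L[ℝ] ℝ).smulRight v)) {ι : Type} [Fintype ι]
    {Y : ι → VField M} (hY : ∀ i, SmoothVFieldOn (Y i) U) {f : ι → ℝ → ℝ} {f' : ι → ℝ}
    (hf : ∀ i, HasDerivAt (f i) (f' i) s)
    (hV : ∀ᶠ r in 𝓝 s, V r = ∑ i, f i r • Y i (γ r)) :
    nablaAlong D γ V s = ∑ i, (f' i • Y i (γ s) + f i s • D (Y i) (γ s) v) := by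
  have hO := (chartAt R4 (γ s)).open_source
  have hsO := mem_chart_source R4 (γ s)
  have hW : IsOpen (U ∩ (chartAt R4 (γ s)).source) := hU.inter hO
  have hsW : γ s ∈ U ∩ (chartAt R4 (γ s)).source := ⟨hs, hsO⟩
  set c : ι → Fin 4 → M → ℝ := fun i k y => dxField (γ s) k y (Y i y) with hc_def
  have hc (i : ι) (k : Fin 4) : DiffFunAt (c i k) (γ s) :=
    (((hY i).mono inter_subset_left).dxField hW inter_subset_right k).mdiffAt hW hsW
  have hE (k : Fin 4) : DiffVFieldAt (partialField (γ s) k) (γ s) :=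
    (smoothVFieldOn_partialField (γ s) k).mdiffAt hO hsO
  -- the derivative of the components of `V` in the chart at `γ s`
  have h1 : deriv (fun r => coords (γ s) (γ r) (V r)) s =
      ∑ i, (f i s • ∑ k, mvfderiv (𝓡 4) (c i k) (γ s) v • EuclideanSpace.single k (1 : ℝ) +
        f' i • coords (γ s) (γ s) (Y i (γ s))) := by
    have h2 : (fun r => coords (γ s) (γ r) (V r)) =ᶠ[𝓝 s]
        fun r => ∑ i, f i r • ∑ k, c i k (γ r) • EuclideanSpace.single k (1 : ℝ) := by
      filter_upwards [hV] with r hr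
      rw [hr, map_sum]
      refine Finset.sum_congr rfl fun i _ => ?_
      rw [map_smul]
      congr 1
      ext j
      simp [hc_def, dxField_apply, Pi.single_apply]
    rw [h2.deriv_eq]
    refine HasDerivAt.deriv ?_
    refine HasDerivAt.fun_sum fun i _ => ?_
    refine ((hf i).smul (HasDerivAt.fun_sum fun k _ =>
      (hasDerivAt_comp_curve (hc i k) hγ).smul_const _)).congr_deriv ?_
    congr 2
    ext j
    simp [hc_def, dxField_apply, Pi.single_apply]
  have h3 (i : ι) : D (Y i) (γ s) v = ∑ k, (c i k (γ s) • D (partialField (γ s) k) (γ s) v +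
      mvfderiv (𝓡 4) (c i k) (γ s) v • partialField (γ s) k (γ s)) := by
    rw [← nabla_sum_smul D _ (fun k _ => hc i k) fun k _ => hE k]
    have h4 : ∀ᶠ y in 𝓝 (γ s), Y i y = ∑ k, c i k y • partialField (γ s) k y :=
      eventually_of_mem (hO.mem_nhds hsO) fun y hy => (sum_dxField_smul_partialField hy _).symm
    have h5 := (hY i).mdiffAt hU hs
    rw [nabla_congr D h5 (mdiffAt_congr h5 (h4.mono fun _ h => h.symm)) h4]
  have h6 (k : Fin 4) : coords (γ s) (γ s) (V s) k = ∑ i, f i s * c i k (γ s) := by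
    rw [hV.self_of_nhds, ← dxField_apply, map_sum]
    simp [hc_def]
  rw [nablaAlong, velocity_eq hγ, h1, nabla_coordField D _ _ hsO]
  have h7 : coordField (γ s) (∑ i, (f i s • ∑ k, mvfderiv (𝓡 4) (c i k) (γ s) v •
        EuclideanSpace.single k (1 : ℝ) + f' i • coords (γ s) (γ s) (Y i (γ s)))) (γ s) =
      ∑ i, (f i s • ∑ k, mvfderiv (𝓡 4) (c i k) (γ s) v • partialField (γ s) k (γ s) +
        f' i • Y i (γ s)) := by
    simp only [coordField, map_sum, map_add, map_smul]
    refine Finset.sum_congr rfl fun i _ => ?_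
    congr 2
    exact coordField_coords hsO _
  rw [h7]
  simp only [h6, h3, Finset.sum_smul]
  rw [Finset.sum_comm, ← Finset.sum_add_distrib]
  refine Finset.sum_congr rfl fun i _ => ?_
  rw [Finset.sum_add_distrib, smul_add]
  simp only [Finset.smul_sum, mul_smul]
  abel

/-- Integral curves of smooth vector fields are smooth. -/
theorem SmoothVFieldOn.contMDiffOn_integralCurve {X : VField M} (hX : SmoothVFieldOn X univ)
    {γ : ℝ → M} {J : Set ℝ} (hJ : IsOpen J)
    (hγ : ∀ s ∈ J, HasMFDerivAt 𝓘(ℝ, ℝ) (𝓡 4) γ s ((1 : ℝ →L[ℝ] ℝ).smulRight (X (γ s)))) :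
    ContMDiffOn 𝓘(ℝ, ℝ) (𝓡 4) ∞ γ J := by
  intro s₀ hs₀
  have hcont : ContinuousOn γ J := fun s hs => (hγ s hs).1.continuousWithinAt
  have hO := (chartAt R4 (γ s₀)).open_source
  have hN := hcont.isOpen_inter_preimage hJ hO
  have hs₀N : s₀ ∈ J ∩ γ ⁻¹' (chartAt R4 (γ s₀)).source := ⟨hs₀, mem_chart_source R4 (γ s₀)⟩
  have hF : ContDiffOn ℝ ∞ ((fun y => Newtonian.coords (γ s₀) y (X y)) ∘
      (extChartAt (𝓡 4) (γ s₀)).symm) (extChartAt (𝓡 4) (γ s₀)).target := by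
    rw [← contMDiffOn_iff_contDiffOn]
    refine ((hX.mono (subset_univ _)).coords hO subset_rfl).comp (contMDiffOn_extChartAt_symm _) ?_
    intro z hz
    have := (extChartAt (𝓡 4) (γ s₀)).map_target hz
    rwa [extChartAt_source] at this
  have hu := contDiffOn_of_hasDerivAt (u := fun r => extChartAt (𝓡 4) (γ s₀) (γ r)) hN hF
    (fun s hs => (extChartAt (𝓡 4) (γ s₀)).map_source (by rw [extChartAt_source]; exact hs.2))
    (fun s hs => by
      have h1 := hasDerivAt_chart_comp_curve hs.2 (hγ s hs.1)
      have h2 : (extChartAt (𝓡 4) (γ s₀)).symm (extChartAt (𝓡 4) (γ s₀) (γ s)) = γ s :=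
        (extChartAt (𝓡 4) (γ s₀)).left_inv (by rw [extChartAt_source]; exact hs.2)
      rw [Function.comp_apply, h2]
      exact h1)
  refine ContMDiffAt.contMDiffWithinAt (contMDiffAt_iff.2 ⟨(hγ s₀ hs₀).1, ?_⟩)
  have h3 := (hu.contDiffAt (hN.mem_nhds hs₀N)).contDiffWithinAt (s := univ)
  simpa [Function.comp_def] using! h3

/-! ### Geodesics tangent to a geodesic field -/

/-- The integral curves of a field with `ξ^a ∇_a ξ^b = 0` are geodesics. -/
theorem isGeodesicOn_integralCurve {D : Connection M} {ξ : VField M} (hξ : SmoothVFieldOn ξ univ)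
    {γ : ℝ → M} {J : Set ℝ} (hJ : IsOpen J) (hJ' : J.OrdConnected) (h0 : (0 : ℝ) ∈ J)
    (hγ : ∀ s ∈ J, HasMFDerivAt 𝓘(ℝ, ℝ) (𝓡 4) γ s ((1 : ℝ →L[ℝ] ℝ).smulRight (ξ (γ s))))
    (hD : ∀ s ∈ J, D ξ (γ s) (ξ (γ s)) = 0) : IsGeodesicOn D γ J where
  isOpen := hJ
  interval := hJ'
  zero_mem := h0
  smooth := hξ.contMDiffOn_integralCurve hJ hγ
  geodesic s hs := by
    rw [nablaAlong_eq_sum D isOpen_univ (mem_univ _) (hγ s hs) (ι := Unit) (Y := fun _ => ξ)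
      (fun _ => hξ) (f := fun _ _ => 1) (fun _ => hasDerivAt_const s 1)
      (eventually_of_mem (hJ.mem_nhds hs) fun r hr => by simp [velocity_eq (hγ r hr)])]
    simp [hD s hs]

/-- The components of the velocity of a smooth curve are differentiable. -/
theorem differentiableAt_coords_velocity {γ : ℝ → M} {J : Set ℝ} (hJ : IsOpen J)
    (hγ : ContMDiffOn 𝓘(ℝ, ℝ) (𝓡 4) ∞ γ J) {s : ℝ} (hs : s ∈ J) {x₀ : M}
    (hx : γ s ∈ (chartAt R4 x₀).source) :
    DifferentiableAt ℝ (fun r => coords x₀ (γ r) (velocity γ r)) s := by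
  have hN := hγ.continuousOn.isOpen_inter_preimage hJ (chartAt R4 x₀).open_source
  have h1 : ContDiffOn ℝ ∞ (fun r => extChartAt (𝓡 4) x₀ (γ r))
      (J ∩ γ ⁻¹' (chartAt R4 x₀).source) := by
    rw [← contMDiffOn_iff_contDiffOn]
    exact (contMDiffOn_extChartAt (n := ∞) (x := x₀)).comp (hγ.mono inter_subset_left)
      inter_subset_right
  have h2 := ((contDiffOn_infty_iff_deriv_of_isOpen hN).1 h1).2
  have h3 := (h2.contDiffAt (hN.mem_nhds ⟨hs, hx⟩)).differentiableAt (by simp)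
  refine h3.congr_of_eventuallyEq ?_
  filter_upwards [hN.mem_nhds ⟨hs, hx⟩] with r hr
  have h4 : MDifferentiableAt 𝓘(ℝ, ℝ) (𝓡 4) γ r :=
    (hγ.contMDiffAt (hJ.mem_nhds hr.1)).mdifferentiableAt (by simp)
  exact (hasDerivAt_chart_comp_curve hr.2 (hasMFDerivAt_velocity h4)).deriv.symm

/-- A geodesic which is tangent to a geodesic field at some parameter stays tangent to it nearby:
the components of the difference of the two velocities solve a linear differential equation. -/
theorem IsGeodesicOn.eventually_velocity_eq [T2Space M] {D : Connection M}
    (hD : CovariantDerivative.ContMDiffCovariantDerivative D ∞) {ξ : VField M}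
    (hξ : SmoothVFieldOn ξ univ) {U : Set M} (hU : IsOpen U) (hDξ : ∀ x ∈ U, D ξ x (ξ x) = 0)
    {γ : ℝ → M} {J : Set ℝ} (hγ : IsGeodesicOn D γ J) {s₀ : ℝ} (hs₀ : s₀ ∈ J) (hs₀U : γ s₀ ∈ U)
    (h0 : velocity γ s₀ = ξ (γ s₀)) : ∀ᶠ s in 𝓝 s₀, velocity γ s = ξ (γ s) := by
  set x₀ := γ s₀ with hx₀
  have hO := (chartAt R4 x₀).open_source
  have hW : IsOpen (U ∩ (chartAt R4 x₀).source) := hU.inter hO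
  have hN := hγ.smooth.continuousOn.isOpen_inter_preimage hγ.isOpen hW
  set N := J ∩ γ ⁻¹' (U ∩ (chartAt R4 x₀).source)
  have hs₀N : s₀ ∈ N := ⟨hs₀, hs₀U, mem_chart_source R4 x₀⟩
  have hv (s) (hs : s ∈ N) := hasMFDerivAt_velocity
    ((hγ.smooth.contMDiffAt (hγ.isOpen.mem_nhds hs.1)).mdifferentiableAt (by simp))
  have hE (i : Fin 4) := smoothVFieldOn_partialField x₀ i
  set w : Fin 4 → ℝ → ℝ := fun i s => dxField x₀ i (γ s) (velocity γ s) with hw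
  set z : ℝ → Fin 4 → ℝ := fun s i => dxField x₀ i (γ s) (velocity γ s - ξ (γ s)) with hz
  have hwd (s) (hs : s ∈ N) (i : Fin 4) : DifferentiableAt ℝ (w i) s :=
    (EuclideanSpace.proj i : R4 →L[ℝ] ℝ).differentiableAt.comp s
      (differentiableAt_coords_velocity hγ.isOpen hγ.smooth hs.1 hs.2.2)
  have hzd (s) (hs : s ∈ N) (i : Fin 4) : DifferentiableAt ℝ (fun r => z r i) s := by
    have h1 : DiffFunAt (fun y => dxField x₀ i y (ξ y)) (γ s) :=
      ((hξ.mono (subset_univ _)).dxField hO subset_rfl i).mdiffAt hO hs.2.2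
    have h2 := (hwd s hs i).sub (hasDerivAt_comp_curve h1 (hv s hs)).differentiableAt
    refine h2.congr_of_eventuallyEq ?_
    exact Eventually.of_forall fun r => by simp [hz, hw]
  -- the coefficients of the linear differential equation
  set b : Fin 4 → Fin 4 → ℝ → ℝ := fun k i s => -(dxField x₀ k (γ s) (D ξ (γ s)
    (partialField x₀ i (γ s))) + ∑ j, w j s * dxField x₀ k (γ s) (D (partialField x₀ i) (γ s)
    (partialField x₀ j (γ s)))) with hb
  have hbc (k i : Fin 4) : ContinuousAt (b k i) s₀ := by
    have hγc : ContinuousAt γ s₀ := (hv s₀ hs₀N).1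
    have h1 {Y : VField M} (hY : SmoothVFieldOn Y (chartAt R4 x₀).source) :
        ContinuousAt (fun s => dxField x₀ k (γ s) (Y (γ s))) s₀ :=
      ContinuousAt.comp (g := fun y => dxField x₀ k y (Y y))
        ((hY.dxField hO subset_rfl k).contMDiffAt (hO.mem_nhds hs₀N.2.2)).continuousAt hγc
    refine ((h1 ((hξ.mono (subset_univ _)).nabla hD (hE i) hO)).add ?_).neg
    refine tendsto_finsetSum _ fun j _ => ?_
    exact (hwd s₀ hs₀N j).continuousAt.mul (h1 ((hE i).nabla hD (hE j) hO))
  have hzeq (s) (hs : s ∈ N) (k : Fin 4) :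
      HasDerivAt (fun r => z r k) (∑ i, b k i s * z s i) s := by
    refine (hzd s hs k).hasDerivAt.congr_deriv ?_
    have h1 := hγ.geodesic s hs.1
    -- the velocity is `ξ + Σ z_i ∂_i`
    rw [nablaAlong_eq_sum D hO hs.2.2 (hv s hs) (ι := Option (Fin 4))
      (Y := fun o => o.elim ξ (partialField x₀))
      (fun o => by cases o with
        | none => exact hξ.mono (subset_univ _)
        | some i => exact hE i)
      (f := fun o r => o.elim 1 (z r))
      (f' := fun o => o.elim 0 fun i => deriv (fun r => z r i) s)
      (fun o => by cases o with
        | none => exact hasDerivAt_const s 1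
        | some i => exact (hzd s hs i).hasDerivAt)
      (eventually_of_mem (hN.mem_nhds hs) fun r hr => by
        simp [Fintype.sum_option, hz, -map_sub, sum_dxField_smul_partialField hr.2.2])] at h1
    have h2 : velocity γ s = ξ (γ s) + ∑ i, z s i • partialField x₀ i (γ s) := by
      simp [hz, -map_sub, sum_dxField_smul_partialField hs.2.2]
    have h3 : D ξ (γ s) (velocity γ s) = ∑ i, z s i • D ξ (γ s) (partialField x₀ i (γ s)) := by
      rw [h2]
      simp [map_sum, hDξ _ hs.2.1]
    have h4 (i : Fin 4) : D (partialField x₀ i) (γ s) (velocity γ s) =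
        ∑ j, w j s • D (partialField x₀ i) (γ s) (partialField x₀ j (γ s)) := by
      conv_lhs => rw [← sum_dxField_smul_partialField hs.2.2 (velocity γ s)]
      simp [map_sum, hw]
    have h5 := congrArg (dxField x₀ k (γ s)) h1
    simp only [Fintype.sum_option, Option.elim_none, Option.elim_some, h3, h4, zero_smul, one_smul,
      map_add, map_sum, map_smul, dxField_partialField hs.2.2, smul_eq_mul, map_zero, zero_add,
      Finset.sum_add_distrib, mul_ite, mul_one, mul_zero, Finset.sum_ite_eq, Finset.mem_univ,
      if_true] at h5
    simp only [hb, neg_mul, add_mul, Finset.sum_neg_distrib, Finset.sum_add_distrib]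
    simp only [mul_comm _ (z s _)]
    linarith
  have hlin := eventually_eq_zero_of_linear (z := z) (s₀ := s₀)
    (B := fun s => ∑ k, ∑ i, b k i s •
      (ContinuousLinearMap.proj i : (Fin 4 → ℝ) →L[ℝ] ℝ).smulRight (Pi.single k 1 : Fin 4 → ℝ))
    (tendsto_finsetSum _ fun k _ => tendsto_finsetSum _ fun i _ => (hbc k i).smul_const _)
    (eventually_of_mem (hN.mem_nhds hs₀N) fun s hs => by
      refine hasDerivAt_pi.2 fun k => (hzeq s hs k).congr_deriv ?_
      simp [Finset.sum_apply, Pi.single_apply])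
    (by
      ext i
      change dxField x₀ i (γ s₀) (velocity γ s₀ - ξ (γ s₀)) = 0
      rw [h0, sub_self, map_zero])
  filter_upwards [hlin, hN.mem_nhds hs₀N] with s hs hsN
  rw [← sub_eq_zero, ← sum_dxField_smul_partialField hsN.2.2 (velocity γ s - ξ (γ s))]
  exact Finset.sum_eq_zero fun i _ => by
    have h1 := congrFun hs i
    simp only [hz, Pi.zero_apply] at h1
    rw [h1, zero_smul]

/-! ### Geodesics tangent to the velocity field -/

theorem exists_Ioo_subset_of_ordConnected {K : Set ℝ} (hK : IsOpen K) (hK' : K.OrdConnected)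
    {a b : ℝ} (ha : a ∈ K) (hb : b ∈ K) :
    ∃ l u, a ∈ Ioo l u ∧ b ∈ Ioo l u ∧ Ioo l u ⊆ K := by
  wlog hab : a ≤ b generalizing a b
  · obtain ⟨l, u, h1, h2, h3⟩ := this hb ha (le_of_not_ge hab)
    exact ⟨l, u, h2, h1, h3⟩
  obtain ⟨l, u', ha', hl⟩ := mem_nhds_iff_exists_Ioo_subset.1 (hK.mem_nhds ha)
  obtain ⟨l', u, hb', hu⟩ := mem_nhds_iff_exists_Ioo_subset.1 (hK.mem_nhds hb)
  refine ⟨l, u, ⟨ha'.1, hab.trans_lt hb'.2⟩, ⟨ha'.1.trans_le hab, hb'.2⟩, fun x hx => ?_⟩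
  rcases le_total x a with h | h
  · exact hl ⟨hx.1, h.trans_lt ha'.2⟩
  rcases le_total x b with h' | h'
  · exact hK'.out ha hb ⟨h, h'⟩
  · exact hu ⟨hb'.1.trans_le h', hx.2⟩

section

variable {t : CovField M} {h : BiField M} {D : Connection M} {ξ : VField M} {T : BiField M}
  (hF : IsFLRWLike t h D ξ T)

include hF

/-- A geodesic which starts tangent to the velocity field at a point with mass is an integral curve
of the velocity field, and the mass density vanishes nowhere on it: by the continuity equation,
`ρ exp (∫ θ)` is constant along it. -/
theorem IsFLRWLike.velocity_eq_and_massDensity_ne_zero [T2Space M]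
    (hcons : ConservationCondition D T) {γ : ℝ → M} {J : Set ℝ} (hγ : IsGeodesicOn D γ J)
    (h0 : velocity γ 0 = ξ (γ 0)) (hρ0 : massDensity t T (γ 0) ≠ 0) {s : ℝ} (hs : s ∈ J) :
    velocity γ s = ξ (γ s) ∧ massDensity t T (γ s) ≠ 0 := by
  have hρ := contMDiff_massDensity hF.spacetime.smooth_t hF.smooth_T
  have hθ := (contMDiff_expansion hF.spacetime.smooth_D hF.smooth_ξ).continuous
  have hU : IsOpen {y | massDensity t T y ≠ 0} := isOpen_ne_fun hρ.continuous continuous_const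
  have hγc (s) (hs : s ∈ J) : ContinuousAt γ s :=
    hγ.smooth.continuousOn.continuousAt (hγ.isOpen.mem_nhds hs)
  have hv (s) (hs : s ∈ J) := hasMFDerivAt_velocity
    ((hγ.smooth.contMDiffAt (hγ.isOpen.mem_nhds hs)).mdifferentiableAt (by simp))
  have hθγ : ContinuousOn (fun r => expansion D ξ (γ r)) J :=
    hθ.comp_continuousOn hγ.smooth.continuousOn
  have hI (s) (hs : s ∈ J) : HasDerivAt (fun s => ∫ r in (0 : ℝ)..s, expansion D ξ (γ r))
      (expansion D ξ (γ s)) s := by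
    refine intervalIntegral.integral_hasDerivAt_right ?_
      (hθγ.stronglyMeasurableAtFilter hγ.isOpen s hs) (hθγ.continuousAt (hγ.isOpen.mem_nhds hs))
    exact (hθγ.mono (hγ.interval.uIcc_subset hγ.zero_mem hs)).intervalIntegrable
  set m : ℝ → ℝ := fun s =>
    massDensity t T (γ s) * Real.exp (∫ r in (0 : ℝ)..s, expansion D ξ (γ r)) with hm
  have hmc (s) (hs : s ∈ J) : ContinuousAt m s :=
    (ContinuousAt.comp (g := massDensity t T) hρ.continuous.continuousAt (hγc s hs)).mul
      (hI s hs).continuousAt.rexp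
  have hm_ne {s : ℝ} (h1 : m s = massDensity t T (γ 0)) : massDensity t T (γ s) ≠ 0 := by
    intro h2
    rw [hm] at h1
    simp only [h2, zero_mul] at h1
    exact hρ0 h1.symm
  set S := {s | s ∈ J ∧ velocity γ s = ξ (γ s) ∧ m s = massDensity t T (γ 0)}
  -- `S` is open and closed in `J`
  have hopen : IsOpen S := by
    refine isOpen_iff_mem_nhds.2 fun s hs => ?_
    have h1 := hγ.eventually_velocity_eq hF.spacetime.smooth_D hF.smooth_ξ hU
      (fun x hx => hF.nabla_self hx) hs.1 (hm_ne hs.2.2) hs.2.1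
    have h2 : ∀ᶠ r in 𝓝 s, massDensity t T (γ r) ≠ 0 :=
      (hγc s hs.1).eventually (hU.mem_nhds (hm_ne hs.2.2))
    obtain ⟨ε, hε, hball⟩ := Metric.eventually_nhds_iff_ball.1
      ((h1.and h2).and (hγ.isOpen.mem_nhds hs.1))
    have hd (r) (hr : r ∈ Metric.ball s ε) : HasDerivAt m 0 r := by
      obtain ⟨⟨h3, h4⟩, h5⟩ := hball r hr
      have h6 := hasDerivAt_comp_curve (hρ.mdifferentiable (by simp) (γ r)) (hv r h5)
      rw [h3, hF.mvfderiv_massDensity hcons h4] at h6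
      refine (h6.mul (hI r h5).exp).congr_deriv ?_
      ring
    refine mem_of_superset (Metric.ball_mem_nhds s hε) fun r hr => ?_
    refine ⟨(hball r hr).2, (hball r hr).1.1, ?_⟩
    rw [← hs.2.2]
    exact Metric.isOpen_ball.is_const_of_deriv_eq_zero (convex_ball s ε).isPreconnected
      (fun r hr => (hd r hr).differentiableAt.differentiableWithinAt) (fun r hr => (hd r hr).deriv)
      hr (Metric.mem_ball_self hε)
  have hclosed : closure S ∩ J ⊆ S := by
    rintro s ⟨hs, hsJ⟩
    have hf := mem_closure_iff_frequently.1 hs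
    refine ⟨hsJ, ?_, tendsto_nhds_unique_of_frequently_eq (hmc s hsJ) tendsto_const_nhds
      (hf.mono fun r hr => hr.2.2)⟩
    have hO := (chartAt R4 (γ s)).open_source
    have hsO := mem_chart_source R4 (γ s)
    have h1 := (differentiableAt_coords_velocity hγ.isOpen hγ.smooth hsJ hsO).continuousAt
    have h2 : ContinuousAt (fun r => coords (γ s) (γ r) (ξ (γ r))) s :=
      ContinuousAt.comp (g := fun y => coords (γ s) y (ξ y))
        (((hF.smooth_ξ.mono (subset_univ _)).coords hO subset_rfl).contMDiffAt
          (hO.mem_nhds hsO)).continuousAt (hγc s hsJ)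
    have h3 := tendsto_nhds_unique_of_frequently_eq h1 h2 (hf.mono fun r hr => by rw [hr.2.1])
    beta_reduce at h3
    rw [← coordField_coords hsO (velocity γ s), h3, coordField_coords hsO]
  have h0S : (0 : ℝ) ∈ S := ⟨hγ.zero_mem, h0, by simp [hm]⟩
  have hsS := hγ.interval.isPreconnected.subset_of_closure_inter_subset hopen
    ⟨0, hγ.zero_mem, h0S⟩ hclosed hs
  exact ⟨hsS.2.1, hm_ne hsS.2.2⟩

end

omit [IsManifold (𝓡 4) ∞ M] in
theorem eq_of_mk_eq_mk {ξ : VField M} {x y : M} {v : Tan x}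
    (h : (⟨x, v⟩ : TangentBundle (𝓡 4) M) = ⟨y, ξ y⟩) : v = ξ x := by
  cases h
  rfl

omit [IsManifold (𝓡 4) ∞ M] in
theorem hasMFDerivAt_congr_curve {ξ : VField M} {γ γ' : ℝ → M} {s : ℝ} (h : γ =ᶠ[𝓝 s] γ')
    (hγ : HasMFDerivAt 𝓘(ℝ, ℝ) (𝓡 4) γ' s ((1 : ℝ →L[ℝ] ℝ).smulRight (ξ (γ' s)))) :
    HasMFDerivAt 𝓘(ℝ, ℝ) (𝓡 4) γ s ((1 : ℝ →L[ℝ] ℝ).smulRight (ξ (γ s))) :=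
  (hγ.congr_of_eventuallyEq h).congr_mfderiv
    (congrArg (fun x => (1 : ℝ →L[ℝ] ℝ).smulRight (ξ x : R4)) h.self_of_nhds.symm)

/-- Integral curves of a smooth vector field on an interval are determined by their value at one
parameter. -/
theorem eqOn_of_integralCurve [T2Space M] {ξ : VField M} (hξ : SmoothVFieldOn ξ univ)
    {γ γ' : ℝ → M} {K : Set ℝ} (hK : IsOpen K) (hK' : K.OrdConnected) {a : ℝ} (ha : a ∈ K)
    (hγ : ∀ s ∈ K, HasMFDerivAt 𝓘(ℝ, ℝ) (𝓡 4) γ s ((1 : ℝ →L[ℝ] ℝ).smulRight (ξ (γ s))))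
    (hγ' : ∀ s ∈ K, HasMFDerivAt 𝓘(ℝ, ℝ) (𝓡 4) γ' s ((1 : ℝ →L[ℝ] ℝ).smulRight (ξ (γ' s))))
    (h : γ a = γ' a) : EqOn γ γ' K := by
  intro s hs
  obtain ⟨l, u, hl, hu, hsub⟩ := exists_Ioo_subset_of_ordConnected hK hK' ha hs
  have : IsManifold (𝓡 4) 1 M := IsManifold.of_le (n := ∞) (by simp)
  exact isMIntegralCurveOn_Ioo_eqOn_of_contMDiff_boundaryless (v := ξ) hl
    ((contMDiffOn_univ.1 hξ).of_le (by simp))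
    (fun r hr => (hγ r (hsub hr)).hasMFDerivWithinAt)
    (fun r hr => (hγ' r (hsub hr)).hasMFDerivWithinAt) h hu

/-! ### Maximal geodesics and incompleteness -/

/-- Through every point with mass there is a maximal geodesic which is an integral curve of the
velocity field and stays where there is mass. -/
theorem IsFLRWLike.exists_isMaximalGeodesic [T2Space M] {t : CovField M} {h : BiField M}
    {D : Connection M} {ξ : VField M} {T : BiField M} (hF : IsFLRWLike t h D ξ T)
    (hcons : ConservationCondition D T) {p : M} (hp : massDensity t T p ≠ 0) :
    ∃ (γ : ℝ → M) (J : Set ℝ), IsMaximalGeodesic D γ J ∧ ∀ s ∈ J,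
      HasMFDerivAt 𝓘(ℝ, ℝ) (𝓡 4) γ s ((1 : ℝ →L[ℝ] ℝ).smulRight (ξ (γ s))) ∧
        massDensity t T (γ s) ≠ 0 := by
  have hρ := (contMDiff_massDensity hF.spacetime.smooth_t hF.smooth_T).continuous
  have hU : IsOpen {y | massDensity t T y ≠ 0} := isOpen_ne_fun hρ continuous_const
  -- the geodesics with initial velocity `ξ` at `p`
  set 𝒢 : Set ((ℝ → M) × Set ℝ) :=
    {c | IsGeodesicOn D c.1 c.2 ∧ c.1 0 = p ∧ velocity c.1 0 = ξ (c.1 0)}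
  have hint (c) (hc : c ∈ 𝒢) (s) (hs : s ∈ c.2) :
      HasMFDerivAt 𝓘(ℝ, ℝ) (𝓡 4) c.1 s ((1 : ℝ →L[ℝ] ℝ).smulRight (ξ (c.1 s))) ∧
        massDensity t T (c.1 s) ≠ 0 := by
    have h1 := hF.velocity_eq_and_massDensity_ne_zero hcons hc.1 hc.2.2
      (by rw [hc.2.1]; exact hp) hs
    refine ⟨?_, h1.2⟩
    rw [← h1.1]
    exact hasMFDerivAt_velocity
      ((hc.1.smooth.contMDiffAt (hc.1.isOpen.mem_nhds hs)).mdifferentiableAt (by simp))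
  have hagree (c) (hc : c ∈ 𝒢) (c') (hc' : c' ∈ 𝒢) : EqOn c.1 c'.1 (c.2 ∩ c'.2) :=
    eqOn_of_integralCurve hF.smooth_ξ (hc.1.isOpen.inter hc'.1.isOpen)
      (hc.1.interval.inter hc'.1.interval) ⟨hc.1.zero_mem, hc'.1.zero_mem⟩
      (fun s hs => (hint c hc s hs.1).1) (fun s hs => (hint c' hc' s hs.2).1)
      (hc.2.1.trans hc'.2.1.symm)
  obtain ⟨c₀, hc₀⟩ : ∃ c, c ∈ 𝒢 := by
    have : IsManifold (𝓡 4) 1 M := IsManifold.of_le (n := ∞) (by simp)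
    obtain ⟨γ, hγ0, hγ⟩ := exists_isMIntegralCurveAt_of_contMDiffAt_boundaryless (v := ξ) 0
      (((contMDiffOn_univ.1 hF.smooth_ξ).of_le (by simp)) p)
    have h1 : ∀ᶠ s in 𝓝 (0 : ℝ), massDensity t T (γ s) ≠ 0 :=
      hγ.continuousAt.eventually (hU.mem_nhds (by rw [hγ0]; exact hp))
    obtain ⟨ε, hε, hball⟩ := Metric.eventually_nhds_iff_ball.1 (Eventually.and hγ h1)
    exact ⟨(γ, Metric.ball 0 ε), isGeodesicOn_integralCurve hF.smooth_ξ Metric.isOpen_ball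
      (convex_ball 0 ε).ordConnected (Metric.mem_ball_self hε) (fun s hs => (hball s hs).1)
      (fun s hs => hF.nabla_self (hball s hs).2), hγ0,
      velocity_eq (hball 0 (Metric.mem_ball_self hε)).1⟩
  -- the union of all these geodesics
  set J : Set ℝ := ⋃ c ∈ 𝒢, c.2 with hJ
  have hmem {s : ℝ} (hs : s ∈ J) : ∃ c ∈ 𝒢, s ∈ c.2 := by simpa [hJ] using hs
  have hsub {c : (ℝ → M) × Set ℝ} (hc : c ∈ 𝒢) : c.2 ⊆ J :=
    subset_biUnion_of_mem (u := Prod.snd) hc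
  obtain ⟨γ, hγ⟩ : ∃ γ : ℝ → M, ∀ c ∈ 𝒢, EqOn c.1 γ c.2 := by
    have h1 (s : ℝ) : ∃ x : M, ∀ c ∈ 𝒢, s ∈ c.2 → c.1 s = x := by
      by_cases hs : s ∈ J
      · obtain ⟨c, hc, hcs⟩ := hmem hs
        exact ⟨c.1 s, fun c' hc' hcs' => hagree c' hc' c hc ⟨hcs', hcs⟩⟩
      · exact ⟨p, fun c hc hcs => absurd (hsub hc hcs) hs⟩
    choose γ hγ using h1
    exact ⟨γ, fun c hc s hs => hγ s c hc hs⟩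
  have hJo : IsOpen J := isOpen_biUnion fun c hc => hc.1.isOpen
  have hJc : J.OrdConnected := by
    rw [← isPreconnected_iff_ordConnected, hJ, ← sUnion_image]
    exact isPreconnected_sUnion 0 _ (forall_mem_image.2 fun c hc => hc.1.zero_mem)
      (forall_mem_image.2 fun c hc => hc.1.interval.isPreconnected)
  have hγint (s) (hs : s ∈ J) :
      HasMFDerivAt 𝓘(ℝ, ℝ) (𝓡 4) γ s ((1 : ℝ →L[ℝ] ℝ).smulRight (ξ (γ s))) ∧
        massDensity t T (γ s) ≠ 0 := by
    obtain ⟨c, hc, hcs⟩ := hmem hs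
    have h1 := hint c hc s hcs
    refine ⟨hasMFDerivAt_congr_curve
      (eventually_of_mem (hc.1.isOpen.mem_nhds hcs) fun r hr => (hγ c hc hr).symm) h1.1, ?_⟩
    rw [← hγ c hc hcs]
    exact h1.2
  have h0 : (0 : ℝ) ∈ J := hsub hc₀ hc₀.1.zero_mem
  refine ⟨γ, J, ⟨isGeodesicOn_integralCurve hF.smooth_ξ hJo hJc h0 (fun s hs => (hγint s hs).1)
    fun s hs => hF.nabla_self (hγint s hs).2, fun γ' J' hγ' hinit => ?_⟩, hγint⟩
  rw [velocity_eq (hγint 0 h0).1] at hinit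
  have hc : (γ', J') ∈ 𝒢 := by
    refine ⟨hγ', (congrArg TotalSpace.proj hinit).trans ?_, eq_of_mk_eq_mk hinit⟩
    exact (hγ c₀ hc₀ hc₀.1.zero_mem).symm.trans hc₀.2.1
  exact ⟨hsub hc, hγ _ hc⟩

/-- An FLRW-like spacetime which has mass somewhere is timelike geodesically incomplete. -/
theorem IsFLRWLike.isTimelikeIncomplete [T2Space M] {t : CovField M} {h : BiField M}
    {D : Connection M} {ξ : VField M} {T : BiField M} (hF : IsFLRWLike t h D ξ T)
    (hcons : ConservationCondition D T) (hmass : MassCondition t T) {p : M}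
    (hp : massDensity t T p ≠ 0) : IsTimelikeIncomplete t D := by
  obtain ⟨γ, J, hmax, hγ⟩ := hF.exists_isMaximalGeodesic hcons hp
  refine ⟨γ, J, hmax, fun s hs => ?_, ?_⟩
  · rw [velocity_eq (hγ s hs).1]
    exact hF.timelike_ξ (γ s)
  · rintro rfl
    have hθ := (contMDiff_expansion hF.spacetime.smooth_D hF.smooth_ξ).mdifferentiable (by simp)
    refine not_riccati (θ := fun s => expansion D ξ (γ s))
      (k := fun s => 4 * Real.pi * massDensity t T (γ s)) (fun s => ?_) fun s => ?_
    · have h1 := hasDerivAt_comp_curve (hθ (γ s)) (hγ s (mem_univ s)).1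
      rwa [hF.mvfderiv_expansion (hγ s (mem_univ s)).2] at h1
    · have h1 := (hmass (γ s)).lt_of_ne' (hγ s (mem_univ s)).2
      positivity

end

end Newtonian

theorem theorem2 {M : Type*} [TopologicalSpace M] [T2Space M] [ParacompactSpace M]
    [ChartedSpace (EuclideanSpace ℝ (Fin 4)) M] [IsManifold (𝓡 4) ∞ M]
    (t : Newtonian.CovField M) (h : Newtonian.BiField M) (D : Newtonian.Connection M)
    (ξ : Newtonian.VField M) (T : Newtonian.BiField M)
    (hFLRW : Newtonian.IsFLRWLike t h D ξ T)
    (hcons : Newtonian.ConservationCondition D T)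
    (hmass : Newtonian.MassCondition t T) :
    (∀ x : M, Newtonian.massDensity t T x = 0) ∨ Newtonian.IsTimelikeIncomplete t D := by
  by_cases hρ : ∀ x : M, Newtonian.massDensity t T x = 0
  · exact Or.inl hρ
  · obtain ⟨p, hp⟩ := not_forall.1 hρ
    exact Or.inr (hFLRW.isTimelikeIncomplete hcons hmass hp)
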